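/- **Setting.** Let $\lambda>0$ and $p\in[0,1]$. Call $x=(x_1,x_2)\in\mathbb Z^2$ even if $x_1+x_2$ is even and odd otherwise. At the sites of $\mathbb Z^2$ there are independent Poisson arrival processes, of rate $\lambda$ at each even site and of rate $1$ at each odd site; let $t_x$ be the time of the first arrival at $x$. In random sequential adsorption with arrival times $(t_x)$ all sites start empty; at time $t_x$ the site $x$ becomes occupied if none of its four neighbours is occupied, and a site becomes blocked once one of its neighbours is occupied. Almost surely every site is eventually either occupied or blocked. An even site is black if occupied and white if blocked; an odd site is black if blocked and white if occupied. To each diamond site $z'=z+(\tfrac12,\tfrac12)$, $z\in\mathbb Z^2$, attach an enhancement variable $T_{z'}$, uniform on $[0,1]$, all independent of each other and of the arrivals; $z'$ is black if $T_{z'}<p$ and white otherwise. Consider the graph on the sites and the diamond sites in which each site is adjacent to its four nearest neighbours in $\mathbb Z^2$ and each diamond site $z'$ is adjacent to the four sites $z$, $z+(1,0)$, $z+(0,1)$, $z+(1,1)$. For $n\in\mathbb N$ let $B(2n)=[-n,n-1]\times[-n,n-1]$, let $H_n$ be the event that there is a path of black vertices of this graph, all lying in $B(2n)$, from a site with first coordinate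 $-n$ to a site with first coordinate $n-1$, and let $h(n,\lambda,p)=P[H_n]$. An even site $x$ is *1-pivotal* if $H_n$ occurs when $t_x$ is set equal to the first arrival time at $x$ but does not occur when $t_x$ is set equal to the second arrival time at $x$, everything else being unchanged. A diamond $x'$ is *2-pivotal* if $H_n$ occurs when $T_{x'}$ is set equal to $0$ but does not occur when $T_{x'}$ is set equal to $1$. Let $P_1(n,\lambda,x)$ be the probability that $x$ is 1-pivotal, and $P_2(n,\lambda,x)$ the probability that $x'$ is 2-pivotal (both also depend on $p$). **Proposition 4.2.** Let $n\in\mathbb N$ and $\lambda>0$. 1. For every $p\in[0,1]$ the series below converges, $h(n,\cdot,p)$ is differentiable at $\lambda$, and $$\frac{\partial h(n,\lambda,p)}{\partial\lambda}=\frac1\lambda\sum_{x\in\mathbb Z^2:\ x\text{ even}}P_1(n,\lambda,x).$$ 2. For every $p\in(0,1]$ the series below converges, $h(n,\lambda,\cdot)$ is differentiable at $p$ as a function on $[0,1]$ (so one-sidedly at $p=1$), and $$\frac{\partial h(n,\lambda,p)}{\partial p}=\sum_{x\in\mathbb Z^2}P_2(n,\lambda,x).$$ -/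

import Mathlib

open MeasureTheory ProbabilityTheory

namespace RSA

/-- The sites of the square lattice `ℤ²`. -/
abbrev Site : Type := ℤ × ℤ

/-- Two sites are neighbours if they are at (graph) distance one in the square lattice. -/
def Neighbour (x y : Site) : Prop := |x.1 - y.1| + |x.2 - y.2| = 1

/-- A site is even if its graph distance from the origin is even. -/
def EvenSite (x : Site) : Prop := Even (|x.1| + |x.2|)

/-- The two possible final states of a site. -/
inductive State : Type
  | occupied
  | blocked

/-- `HasState t x s`: in random sequential adsorption with arrival times `t`, the site `x` ends up
in state `s`. A site becomes occupied on its arrival if no neighbour is occupied at that time,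
that is, if every neighbour that arrived before had been blocked; a site is blocked if a neighbour
that arrived before it is occupied. The inductive predicate is the process run along the arrival
times; almost surely there is no infinite path of decreasing arrival times, and then every site
has exactly one state. -/
inductive HasState (t : Site → ℝ) : Site → State → Prop
  | occupied (x : Site) (h : ∀ y, Neighbour x y → t y < t x → HasState t y State.blocked) :
      HasState t x State.occupied
  | blocked (x y : Site) (hxy : Neighbour x y) (hlt : t y < t x)
      (h : HasState t y State.occupied) : HasState t x State.blocked

/-- Even sites are black if occupied (and white if blocked); odd sites are black if blocked
(and white if occupied). -/
def BlackSite (t : Site → ℝ) (x : Site) : Prop :=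
  (EvenSite x ∧ HasState t x State.occupied) ∨ (¬ EvenSite x ∧ HasState t x State.blocked)

/-- The faces of the `(4,8²)` lattice: the octagon centred at the site `z`, and the diamond
centred at `z' = z + (1/2, 1/2)`, for `z ∈ ℤ²`. -/
inductive Face : Type
  | octagon (z : Site)
  | diamond (z : Site)

/-- Adjacency of an octagon and a diamond: the diamond `z'` is adjacent to the octagons
`z`, `z + (1,0)`, `z + (0,1)` and `z + (1,1)`. -/
def Touches (x z : Site) : Prop := (x.1 = z.1 ∨ x.1 = z.1 + 1) ∧ (x.2 = z.2 ∨ x.2 = z.2 + 1)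

/-- Adjacency of faces of the `(4,8²)` lattice, i.e. adjacency in the centred quadratic lattice. -/
def FaceAdj : Face → Face → Prop
  | .octagon x, .octagon y => Neighbour x y
  | .octagon x, .diamond z => Touches x z
  | .diamond z, .octagon x => Touches x z
  | .diamond _, .diamond _ => False

/-- The centred quadratic lattice, whose vertices are the faces of the `(4,8²)` lattice. -/
def centredQuadraticLattice : SimpleGraph Face where
  Adj := FaceAdj
  symm := ⟨by
    rintro (x | x) (y | y) h
    · simpa only [FaceAdj, Neighbour, abs_sub_comm] using h
    · exact h
    · exact h
    · exact h⟩
  loopless := ⟨by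
    rintro (x | x) h
    · simp [FaceAdj, Neighbour] at h
    · exact h⟩

/-- The centre of a face lies in the box `B(2n) = [-n, n-1] × [-n, n-1]`. (The centre
`z + (1/2, 1/2)` of a diamond lies in this box iff both `z` and `z + (1,1)` do.) -/
def InBox (n : ℕ) : Face → Prop
  | .octagon z => -(n : ℤ) ≤ z.1 ∧ z.1 ≤ n - 1 ∧ -(n : ℤ) ≤ z.2 ∧ z.2 ≤ n - 1
  | .diamond z => -(n : ℤ) ≤ z.1 ∧ z.1 + 1 ≤ n - 1 ∧ -(n : ℤ) ≤ z.2 ∧ z.2 + 1 ≤ n - 1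

/-- Colouring of the faces: octagons are coloured as the corresponding site, the diamond `z'` is
black iff its enhancement variable `T z` is less than `p`. -/
def Black (p : ℝ) (t : Site → ℝ) (T : Site → unitInterval) : Face → Prop
  | .octagon z => BlackSite t z
  | .diamond z => (T z : ℝ) < p

/-- The event `H_n`, as a property of the arrival times `t` and the enhancement variables `T`:
there is a black path inside `B(2n)` from its left side to its right side. -/
def Crossing (n : ℕ) (p : ℝ) (t : Site → ℝ) (T : Site → unitInterval) : Prop :=
  ∃ (u v : Site) (w : centredQuadraticLattice.Walk (.octagon u) (.octagon v)),
    u.1 = -(n : ℤ) ∧ v.1 = (n : ℤ) - 1 ∧ ∀ f ∈ w.support, InBox n f ∧ Black p t T f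

/-- A sample point: the gaps between consecutive arrivals at each site (`(x, 0)` is indexing the
time of the first arrival at `x`, and `(x, k + 1)` the time between arrival number `k + 1` and
arrival number `k + 2`), and the enhancement variables of the diamonds. -/
abbrev Sample : Type := (Site × ℕ → ℝ) × (Site → unitInterval)

/-- The time of the `(k+1)`-th arrival at the site `x`. -/
noncomputable def arrival (ω : Sample) (k : ℕ) (x : Site) : ℝ :=
  ∑ i ∈ Finset.range (k + 1), ω.1 (x, i)

/-- The time `t_x` of the first arrival at `x`. -/
noncomputable def firstArrival (ω : Sample) (x : Site) : ℝ := arrival ω 0 x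

/-- The time of the second arrival at `x`. -/
noncomputable def secondArrival (ω : Sample) (x : Site) : ℝ := arrival ω 1 x

open Classical in
/-- The arrival rate: `lam` at even sites and `1` at odd sites. -/
noncomputable def rate (lam : ℝ) (x : Site) : ℝ := if EvenSite x then lam else 1

/-- The law of the model: independent Poisson arrival processes of rate `rate lam x` at the sites
`x` (independent exponential gaps between arrivals), and independent enhancement variables, uniform
on `[0,1]`. It is meaningful for `lam > 0`. -/
noncomputable def law (lam : ℝ) : Measure Sample :=
  (Measure.infinitePi fun i : Site × ℕ => expMeasure (rate lam i.1)).prod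
    (Measure.infinitePi fun _ : Site => (volume : Measure unitInterval))

/-- `h(n, lam, p)`, the probability of a horizontal black crossing of `B(2n)`. -/
noncomputable def h (n : ℕ) (lam p : ℝ) : ℝ :=
  (law lam).real {ω | Crossing n p (firstArrival ω) ω.2}

/-- The site `x` is 1-pivotal: the crossing occurs if the arrival time at `x` is made equal to the
first arrival there, but not if it is made equal to the second arrival. -/
def Pivotal₁ (n : ℕ) (p : ℝ) (x : Site) (ω : Sample) : Prop :=
  Crossing n p (Function.update (firstArrival ω) x (firstArrival ω x)) ω.2 ∧
    ¬ Crossing n p (Function.update (firstArrival ω) x (secondArrival ω x)) ω.2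

/-- The diamond `x'` is 2-pivotal: the crossing occurs if the enhancement variable of `x'` is made
equal to `0`, but not if it is made equal to `1`. -/
def Pivotal₂ (n : ℕ) (p : ℝ) (x : Site) (ω : Sample) : Prop :=
  Crossing n p (firstArrival ω) (Function.update ω.2 x 0) ∧
    ¬ Crossing n p (firstArrival ω) (Function.update ω.2 x 1)

/-- The probability `P₁(n, lam, x)` (it also depends on `p`) that `x` is 1-pivotal. -/
noncomputable def P₁ (n : ℕ) (lam p : ℝ) (x : Site) : ℝ := (law lam).real {ω | Pivotal₁ n p x ω}

/-- The probability `P₂(n, lam, x)` (it also depends on `p`) that `x'` is 2-pivotal. -/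
noncomputable def P₂ (n : ℕ) (lam p : ℝ) (x : Site) : ℝ := (law lam).real {ω | Pivotal₂ n p x ω}

end RSA

/-!
Running the adsorption process backwards along only `k` generations of decreasing arrival times
turns the crossing event into a local event. For a local event, the derivative in the rate `lam` can
be computed from the density of the gaps: it involves the integrals over the event of the first
arrival times at the even sites. As the sum of two independent exponential gaps is size-biased
exponential, weighting by the first arrival time at `x` amounts to replacing it by the second one,
and the derivative becomes the sum of the influences of the even sites, divided by `lam`. The local
approximation fails only if arrival times decrease along a long walk of double steps between odd
sites, whose probability is at most `16 ^ m / (m + 1)!` up to a constant, uniformly in the rate. So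
the local derivatives converge uniformly. Given the arrivals, the crossing depends on the finite
random set of black diamonds in the box, which makes `h` a polynomial in `p` whose derivative is
given by Russo's formula.
-/

namespace RSA

/-! ### Black sites and adsorption up to a finite depth -/

section Walks

variable {α : Type*} [DecidableEq α] {N : α → Finset α}

/-- The walks `x = c 0, c 1, …, c m` all of whose steps satisfy `c (i + 1) ∈ N (c i)`. -/
def walks (N : α → Finset α) : (m : ℕ) → α → Finset (Fin (m + 1) → α)
  | 0, x => {fun _ => x}
  | m + 1, x => (N x).biUnion fun y => (walks N m y).image (Fin.cons x)

lemma mem_walks {m : ℕ} {x : α} {c : Fin (m + 1) → α} :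
    c ∈ walks N m x ↔ c 0 = x ∧ ∀ i : Fin m, c i.succ ∈ N (c i.castSucc) := by
  induction m generalizing x with
  | zero =>
    simp only [walks, Finset.mem_singleton, IsEmpty.forall_iff, and_true]
    exact ⟨fun h => h ▸ rfl, fun h => funext fun i => by rw [Fin.fin_one_eq_zero i, h]⟩
  | succ m ih =>
    simp only [walks, Finset.mem_biUnion, Finset.mem_image, ih, Fin.forall_fin_succ (n := m)]
    constructor
    · rintro ⟨y, hy, d, ⟨rfl, hd⟩, rfl⟩
      exact ⟨rfl, hy, hd⟩
    · rintro ⟨rfl, h₀, hc⟩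
      exact ⟨c 1, h₀, Fin.tail c, ⟨rfl, hc⟩, Fin.cons_self_tail c⟩

lemma card_walks_le {d : ℕ} (hN : ∀ y, (N y).card ≤ d) (m : ℕ) (x : α) :
    (walks N m x).card ≤ d ^ m := by
  induction m generalizing x with
  | zero => simp [walks]
  | succ m ih =>
    calc (walks N (m + 1) x).card
      _ ≤ (N x).card * d ^ m :=
        Finset.card_biUnion_le_card_mul _ _ _ fun y _ => Finset.card_image_le.trans (ih y)
      _ ≤ d ^ (m + 1) := by rw [pow_succ']; exact Nat.mul_le_mul_right _ (hN x)

end Walks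

/-- The neighbours of a site, as a finite set. -/
def neighbours (x : Site) : Finset Site :=
  {(x.1 + 1, x.2), (x.1 - 1, x.2), (x.1, x.2 + 1), (x.1, x.2 - 1)}

/-- The sites reached from `x` by two steps. -/
def twoSteps (x : Site) : Finset Site := (neighbours x).biUnion neighbours

/-- The square `[-m, m] × [-m, m]`. -/
noncomputable def square (m : ℕ) : Finset Site := Finset.Icc (-(m : ℤ)) m ×ˢ Finset.Icc (-(m : ℤ)) m

lemma mem_neighbours {x y : Site} : y ∈ neighbours x ↔ Neighbour x y := by
  obtain ⟨a, b⟩ := x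
  obtain ⟨c, d⟩ := y
  simp only [neighbours, Neighbour, Finset.mem_insert, Finset.mem_singleton, Prod.mk.injEq]
  rcases abs_cases (a - c) with h | h <;> rcases abs_cases (b - d) with h' | h' <;> omega

lemma card_twoSteps_le (x : Site) : (twoSteps x).card ≤ 16 :=
  (Finset.card_biUnion_le_card_mul _ _ 4 fun _ _ => Finset.card_le_four).trans
    (Nat.mul_le_mul_right 4 Finset.card_le_four)

lemma mem_square {m : ℕ} {x : Site} :
    x ∈ square m ↔ (-(m : ℤ) ≤ x.1 ∧ x.1 ≤ m) ∧ (-(m : ℤ) ≤ x.2 ∧ x.2 ≤ m) := by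
  simp [square, Finset.mem_product]

lemma square_mono : Monotone square := fun m m' h x hx => by
  rw [mem_square] at *
  omega

lemma Neighbour.mem_square {x y : Site} {m : ℕ} (h : Neighbour x y) (hx : x ∈ square m) :
    y ∈ square (m + 1) := by
  have h₁ := abs_le.1 (h ▸ le_add_of_nonneg_right (abs_nonneg _) : |x.1 - y.1| ≤ 1)
  have h₂ := abs_le.1 (h ▸ le_add_of_nonneg_left (abs_nonneg _) : |x.2 - y.2| ≤ 1)
  rw [RSA.mem_square] at *
  omega

lemma Neighbour.evenSite_iff {x y : Site} (h : Neighbour x y) : EvenSite x ↔ ¬ EvenSite y := by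
  have hodd : ¬ Even (|x.1 - y.1| + |x.2 - y.2|) :=
    (congrArg Even (show _ = (1 : ℤ) from h)).mp.mt Int.not_even_one
  simp only [EvenSite, Int.even_add, even_abs, Int.even_sub] at *
  tauto

lemma evenSite_iff_of_mem_twoSteps {x y : Site} (hy : y ∈ twoSteps x) :
    EvenSite y ↔ EvenSite x := by
  obtain ⟨z, hz, hy⟩ := Finset.mem_biUnion.1 hy
  rw [(mem_neighbours.1 hz).evenSite_iff, (mem_neighbours.1 hy).evenSite_iff, not_not]

lemma blackSite_iff {t : Site → ℝ} {x : Site} :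
    BlackSite t x ↔ (EvenSite x ∧ ∀ y, Neighbour x y → t y < t x → BlackSite t y) ∨
      (¬ EvenSite x ∧ ∃ y, Neighbour x y ∧ t y < t x ∧ BlackSite t y) := by
  refine or_congr (and_congr_right fun hx => ?_) (and_congr_right fun hx => ?_)
  · have hodd {y} (hy : Neighbour x y) : BlackSite t y ↔ HasState t y .blocked := by
      simp [BlackSite, hy.evenSite_iff.1 hx]
    refine ⟨?_, fun h => .occupied x fun y hy hlt => (hodd hy).1 (h y hy hlt)⟩
    rintro (⟨_, h⟩ | _)
    exact fun y hy hlt => (hodd hy).2 (h y hy hlt)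
  · have heven {y} (hy : Neighbour x y) : BlackSite t y ↔ HasState t y .occupied := by
      simp [BlackSite, not_not.1 (mt hy.evenSite_iff.2 hx)]
    refine ⟨?_, fun ⟨y, hy, hlt, h⟩ => .blocked x y hy hlt ((heven hy).1 h)⟩
    rintro (_ | ⟨_, y, hy, hlt, h⟩)
    exact ⟨y, hy, hlt, (heven hy).2 h⟩

/-- The site `x` is seen to be black by running the adsorption process backwards along at most `k`
generations of decreasing arrival times. In terms of black and white, an even site is black if all
its earlier neighbours are, an odd one if some earlier neighbour is. -/
def BlackBy (t : Site → ℝ) : ℕ → Site → Prop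
  | 0, _ => False
  | k + 1, x => (EvenSite x ∧ ∀ y, Neighbour x y → t y < t x → BlackBy t k y) ∨
      (¬ EvenSite x ∧ ∃ y, Neighbour x y ∧ t y < t x ∧ BlackBy t k y)

lemma BlackBy.mono {t : Site → ℝ} {k l : ℕ} {x : Site} (hkl : k ≤ l) (h : BlackBy t k x) :
    BlackBy t l x := by
  induction l generalizing k x with
  | zero => rwa [Nat.le_zero.1 hkl] at h
  | succ l ih =>
    cases k with
    | zero => exact h.elim
    | succ k =>
      have ih' {y} : BlackBy t k y → BlackBy t l y := ih (Nat.le_of_succ_le_succ hkl)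
      exact h.imp (And.imp_right fun h y hy hlt => ih' (h y hy hlt))
        (And.imp_right fun ⟨y, hy, hlt, h⟩ => ⟨y, hy, hlt, ih' h⟩)

lemma BlackBy.blackSite {t : Site → ℝ} {k : ℕ} {x : Site} (h : BlackBy t k x) :
    BlackSite t x := by
  induction k generalizing x with
  | zero => exact h.elim
  | succ k ih =>
    exact blackSite_iff.2 (h.imp (And.imp_right fun h y hy hlt => ih (h y hy hlt))
      (And.imp_right fun ⟨y, hy, hlt, h⟩ => ⟨y, hy, hlt, ih h⟩))

lemma HasState.exists_blackBy {t : Site → ℝ} {x : Site} {s : State} (h : HasState t x s)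
    (hs : EvenSite x ↔ s = .occupied) : ∃ k, BlackBy t k x := by
  induction h with
  | occupied x _ ih =>
    have hx : EvenSite x := hs.2 rfl
    choose! K hK using fun y hy hlt => ih y hy hlt (by simp [hy.evenSite_iff.1 hx])
    exact ⟨(neighbours x).sup K + 1, .inl ⟨hx, fun y hy hlt =>
      (hK y hy hlt).mono (Finset.le_sup (mem_neighbours.2 hy))⟩⟩
  | blocked x y hy hlt _ ih =>
    have hx : ¬ EvenSite x := by simp [hs]
    obtain ⟨k, hk⟩ := ih (by simpa using not_not.1 (mt hy.evenSite_iff.2 hx))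
    exact ⟨k + 1, .inr ⟨hx, y, hy, hlt, hk⟩⟩

lemma BlackSite.exists_blackBy {t : Site → ℝ} {x : Site} (h : BlackSite t x) :
    ∃ k, BlackBy t k x := by
  rcases h with ⟨hx, h⟩ | ⟨hx, h⟩ <;> exact h.exists_blackBy (by simp [hx])

lemma blackBy_congr {t t' : Site → ℝ} {k m : ℕ} {x : Site} (hx : x ∈ square m)
    (ht : ∀ y ∈ square (m + k), t y = t' y) : BlackBy t k x ↔ BlackBy t' k x := by
  induction k generalizing m x with
  | zero => exact Iff.rfl
  | succ k ih =>
    have hlt {y} (hy : Neighbour x y) : t y < t x ↔ t' y < t' x := by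
      rw [ht y (square_mono (by omega) (hy.mem_square hx)), ht x (square_mono (by omega) hx)]
    have ih' {y} (hy : Neighbour x y) : BlackBy t k y ↔ BlackBy t' k y :=
      ih (hy.mem_square hx) fun z hz => ht z (square_mono (by omega) hz)
    refine or_congr
      (and_congr_right fun _ => forall_congr' fun y => forall_congr' fun hy => ?_)
      (and_congr_right fun _ => exists_congr fun y => and_congr_right fun hy => ?_) <;>
    rw [hlt hy, ih' hy]

/-- A black even site stays black when its arrival is advanced, a black odd site when its arrival
is delayed: this is the monotonicity behind the sign of the derivatives. -/
lemma BlackBy.anti {t t' : Site → ℝ} (he : ∀ x, EvenSite x → t x ≤ t' x)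
    (ho : ∀ x, ¬ EvenSite x → t' x ≤ t x) {k : ℕ} {x : Site} (h : BlackBy t' k x) :
    BlackBy t k x := by
  induction k generalizing x with
  | zero => exact h.elim
  | succ k ih =>
    refine h.imp (fun ⟨hx, h⟩ => ⟨hx, fun y hy hlt => ih (h y hy ?_)⟩)
      (fun ⟨hx, y, hy, hlt, h⟩ => ⟨hx, y, hy, ?_, ih h⟩)
    · exact ((ho y (hy.evenSite_iff.1 hx)).trans_lt hlt).trans_le (he x hx)
    · exact ((he y (not_not.1 (mt hy.evenSite_iff.2 hx))).trans_lt hlt).trans_le (ho x hx)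

lemma BlackSite.anti {t t' : Site → ℝ} (he : ∀ x, EvenSite x → t x ≤ t' x)
    (ho : ∀ x, ¬ EvenSite x → t' x ≤ t x) {x : Site} (h : BlackSite t' x) : BlackSite t x :=
  let ⟨_, hk⟩ := h.exists_blackBy
  (hk.anti he ho).blackSite

lemma BlackSite.exists_neighbour_of_not_blackBy {t : Site → ℝ} {k : ℕ} {x : Site}
    (h : BlackSite t x) (hk : ¬ BlackBy t (k + 1) x) :
    ∃ y, Neighbour x y ∧ t y < t x ∧ BlackSite t y ∧ ¬ BlackBy t k y := by
  rcases blackSite_iff.1 h with ⟨hx, h⟩ | ⟨hx, y, hy, hlt, h⟩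
  · simp only [BlackBy, hx, true_and, not_true, false_and, or_false, not_forall] at hk
    obtain ⟨y, hy, hlt, hk⟩ := hk
    exact ⟨y, hy, hlt, h y hy hlt, hk⟩
  · exact ⟨y, hy, hlt, h, fun hk' => hk (.inr ⟨hx, y, hy, hlt, hk'⟩)⟩

lemma BlackSite.exists_strictAnti {t : Site → ℝ} {m : ℕ} {x : Site} (h : BlackSite t x)
    (hm : ¬ BlackBy t (2 * m) x) : ∃ c ∈ walks twoSteps m x, StrictAnti (t ∘ c) := by
  suffices ∃ c : Fin (m + 1) → Site, c 0 = x ∧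
      ∀ i : Fin m, c i.succ ∈ twoSteps (c i.castSucc) ∧ t (c i.succ) < t (c i.castSucc) by
    obtain ⟨c, hc₀, hc⟩ := this
    exact ⟨c, mem_walks.2 ⟨hc₀, fun i => (hc i).1⟩, Fin.strictAnti_iff_succ_lt.2 fun i => (hc i).2⟩
  induction m generalizing x with
  | zero => exact ⟨fun _ => x, rfl, fun i => i.elim0⟩
  | succ m ih =>
    obtain ⟨y, hxy, hyx, hy, hky⟩ := h.exists_neighbour_of_not_blackBy hm
    obtain ⟨z, hyz, hzy, hz, hkz⟩ := hy.exists_neighbour_of_not_blackBy hky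
    obtain ⟨c, rfl, hc⟩ := ih hz hkz
    have hstep : c 0 ∈ twoSteps x :=
      Finset.mem_biUnion.2 ⟨y, mem_neighbours.2 hxy, mem_neighbours.2 hyz⟩
    exact ⟨Fin.cons x c, rfl, Fin.cases ⟨hstep, hzy.trans hyx⟩ hc⟩

/-- Double steps keep the parity, so the walk stays on the odd sites, whose arrivals are
identically distributed whatever the rate at the even sites. -/
lemma BlackSite.exists_odd_strictAnti {t : Site → ℝ} {n m : ℕ} {x : Site} (hx : x ∈ square n)
    (h : BlackSite t x) (hm : ¬ BlackBy t (2 * m + 1) x) :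
    ∃ y ∈ square (n + 1), ¬ EvenSite y ∧ ∃ c ∈ walks twoSteps m y, StrictAnti (t ∘ c) := by
  by_cases he : EvenSite x
  · obtain ⟨y, hxy, -, hy, hky⟩ := h.exists_neighbour_of_not_blackBy hm
    exact ⟨y, hxy.mem_square hx, hxy.evenSite_iff.1 he, hy.exists_strictAnti hky⟩
  · exact ⟨x, square_mono n.le_succ hx, he,
      h.exists_strictAnti fun hk => hm (hk.mono (Nat.le_succ _))⟩

lemma evenSite_iff_of_mem_walks {m : ℕ} {x : Site} {c : Fin (m + 1) → Site}
    (hc : c ∈ walks twoSteps m x) (i : Fin (m + 1)) : EvenSite (c i) ↔ EvenSite x := by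
  obtain ⟨rfl, hstep⟩ := mem_walks.1 hc
  induction i using Fin.induction with
  | zero => rfl
  | succ i ih => rw [evenSite_iff_of_mem_twoSteps (hstep i), ih]

/-! ### Random finite sets and product measures -/

section RandomFinsets

variable {Ω ι : Type*} [MeasurableSpace Ω]

open Classical in
lemma measurableSet_filter_eq {K A : Finset ι} {P : Ω → ι → Prop}
    (hP : ∀ i, MeasurableSet {ω | P ω i}) : MeasurableSet {ω | K.filter (P ω) = A} := by
  have : {ω | K.filter (P ω) = A} = {_ω | A ⊆ K} ∩ ⋂ i ∈ K, {ω | P ω i ↔ i ∈ A} := by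
    ext
    simp only [Finset.ext_iff, Finset.mem_filter, Set.mem_ofPred_eq, Set.mem_inter_iff,
      Set.mem_iInter, Finset.subset_iff]
    grind
  rw [this]
  refine (MeasurableSet.const _).inter (Finset.measurableSet_biInter _ fun i _ => ?_)
  by_cases hi : i ∈ A
  · simpa only [hi, iff_true] using hP i
  · simp only [hi, iff_false]
    exact (hP i).compl

open Classical in
lemma measurableSet_filter {K : Finset ι} {P : Ω → ι → Prop}
    (hP : ∀ i, MeasurableSet {ω | P ω i}) (Φ : Finset ι → Prop) :
    MeasurableSet {ω | Φ (K.filter (P ω))} := by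
  have : {ω | Φ (K.filter (P ω))} = ⋃ A ∈ K.powerset.filter Φ, {ω | K.filter (P ω) = A} := by
    ext ω
    simp
  rw [this]
  exact Finset.measurableSet_biUnion _ fun A _ => measurableSet_filter_eq hP

lemma measureReal_prod_finset {Ω' : Type*} [MeasurableSpace Ω'] (μ : Measure Ω) (ν : Measure Ω')
    [IsFiniteMeasure μ] [IsFiniteMeasure ν] {D : Finset ι} {F : Ω' → Finset ι}
    (hF : ∀ A, MeasurableSet {ω | F ω = A}) (hFD : ∀ ω, F ω ⊆ D) {Q : Ω → Finset ι → Prop}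
    (hQ : ∀ A, MeasurableSet {ω | Q ω A}) :
    (μ.prod ν).real {ω | Q ω.1 (F ω.2)} =
      ∑ A ∈ D.powerset, ν.real {ω | F ω = A} * μ.real {ω | Q ω A} := by
  have hunion : {ω : Ω × Ω' | Q ω.1 (F ω.2)} =
      ⋃ A ∈ D.powerset, {ω | Q ω A} ×ˢ {ω | F ω = A} := by
    ext ω
    simp only [Set.mem_iUnion, Set.mem_prod, Set.mem_ofPred_eq, Finset.mem_powerset]
    exact ⟨fun h => ⟨_, hFD ω.2, h, rfl⟩, fun ⟨_, _, h, hA⟩ => hA ▸ h⟩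
  rw [hunion, measureReal_biUnion_finset]
  · simp only [measureReal_prod_prod, mul_comm]
  · exact fun _ _ _ _ hAB => Set.disjoint_left.2 fun ω hA hB => hAB (hA.2.symm.trans hB.2)
  · exact fun A _ => (hQ A).prod (hF A)

open Classical in
lemma measureReal_infinitePi_filter_mem_eq {X : Type*} [MeasurableSpace X] {μ : Measure X}
    [IsProbabilityMeasure μ] {U : Set X} (hU : MeasurableSet U) {D A : Finset ι} (hA : A ⊆ D) :
    (Measure.infinitePi fun _ : ι => μ).real {T | D.filter (T · ∈ U) = A} =
      μ.real U ^ A.card * (1 - μ.real U) ^ (D.card - A.card) := by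
  have hpi : {T : ι → X | D.filter (T · ∈ U) = A} =
      Set.pi (D : Set ι) fun i => if i ∈ A then U else Uᶜ := by
    ext T
    simp only [Finset.ext_iff, Finset.mem_filter, Set.mem_ofPred_eq, Set.mem_pi, Finset.mem_coe]
    refine ⟨fun h i hi => ?_, fun h i => ⟨fun hi => ?_, fun hi => ?_⟩⟩
    · split_ifs with hiA
      · exact ((h i).2 hiA).2
      · exact fun hiU => hiA ((h i).1 ⟨hi, hiU⟩)
    · by_contra hiA
      have := h i hi.1
      rw [if_neg hiA] at this
      exact this hi.2
    · have := h i (hA hi)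
      rw [if_pos hi] at this
      exact ⟨hA hi, this⟩
  have hval (i : ι) : μ.real (if i ∈ A then U else Uᶜ) =
      if i ∈ A then μ.real U else 1 - μ.real U := by
    split_ifs
    · rfl
    · exact probReal_compl_eq_one_sub hU
  rw [hpi, measureReal_def, Measure.infinitePi_pi _ fun i _ => by split_ifs <;> measurability,
    ENNReal.toReal_prod]
  simp only [← measureReal_def, hval]
  rw [Finset.prod_ite, Finset.prod_const, Finset.prod_const, Finset.filter_mem_eq_inter,
    Finset.inter_eq_right.2 hA, Finset.filter_notMem_eq_sdiff, Finset.card_sdiff_of_subset hA]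

end RandomFinsets

section BernoulliMean

variable {ι : Type*}

/-- The mean of `g` over a random subset of `D` which contains each element of `D` independently
with probability `p`. -/
def bernoulliMean (D : Finset ι) (g : Finset ι → ℝ) (p : ℝ) : ℝ :=
  ∑ A ∈ D.powerset, p ^ A.card * (1 - p) ^ (D.card - A.card) * g A

lemma bernoulliMean_congr {D : Finset ι} {g g' : Finset ι → ℝ} {p : ℝ}
    (h : ∀ A ⊆ D, g A = g' A) : bernoulliMean D g p = bernoulliMean D g' p :=
  Finset.sum_congr rfl fun A hA => by rw [h A (Finset.mem_powerset.1 hA)]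

lemma bernoulliMean_sub (D : Finset ι) (g g' : Finset ι → ℝ) (p : ℝ) :
    bernoulliMean D (fun A => g A - g' A) p = bernoulliMean D g p - bernoulliMean D g' p := by
  simp only [bernoulliMean, mul_sub, Finset.sum_sub_distrib]

variable [DecidableEq ι]

lemma bernoulliMean_insert {D : Finset ι} {z : ι} (hz : z ∉ D) (g : Finset ι → ℝ) (p : ℝ) :
    bernoulliMean (insert z D) g p =
      p * bernoulliMean D (fun A => g (insert z A)) p + (1 - p) * bernoulliMean D g p := by
  simp only [bernoulliMean]
  rw [Finset.sum_powerset_insert hz, add_comm, Finset.mul_sum, Finset.mul_sum]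
  congr 1 <;> refine Finset.sum_congr rfl fun A hA => ?_ <;> rw [Finset.mem_powerset] at hA
  · rw [Finset.card_insert_of_notMem hz, Finset.card_insert_of_notMem (fun h => hz (hA h)),
      Nat.add_sub_add_right, pow_succ]
    ring
  · rw [Finset.card_insert_of_notMem hz, Nat.sub_add_comm (Finset.card_le_card hA), pow_succ]
    ring

/-- Russo's formula, for functions which need not be monotone. -/
lemma hasDerivAt_bernoulliMean (D : Finset ι) (g : Finset ι → ℝ) (p : ℝ) :
    HasDerivAt (bernoulliMean D g)
      (∑ z ∈ D, bernoulliMean D (fun A => g (insert z A) - g (A.erase z)) p) p := by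
  induction D using Finset.induction_on generalizing g with
  | empty =>
    have hconst : bernoulliMean ∅ g = fun _ => g ∅ := funext fun _ => by simp [bernoulliMean]
    simpa only [hconst, Finset.sum_empty] using hasDerivAt_const p (g ∅)
  | insert a D ha ih =>
    have hrec := ((hasDerivAt_id p).mul (ih fun A => g (insert a A))).add
      (((hasDerivAt_const p 1).sub (hasDerivAt_id p)).mul (ih g))
    refine (hrec.congr_of_eventuallyEq
      (.of_forall fun q => bernoulliMean_insert ha g q)).congr_deriv ?_
    have hself : bernoulliMean (insert a D) (fun A => g (insert a A) - g (A.erase a)) p =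
        bernoulliMean D (fun A => g (insert a A)) p - bernoulliMean D g p := by
      rw [bernoulliMean_insert ha, ← bernoulliMean_sub]
      have hnot {A} (hA : A ⊆ D) : a ∉ A := fun h => ha (hA h)
      rw [bernoulliMean_congr (g' := fun A => g (insert a A) - g A) fun A hA => by
          rw [Finset.insert_idem, Finset.erase_insert (hnot hA)],
        bernoulliMean_congr (g := fun A => g (insert a A) - g (A.erase a))
          (g' := fun A => g (insert a A) - g A) fun A hA => by
            rw [Finset.erase_eq_of_notMem (hnot hA)]]
      ring
    have hother (z) (hz : z ∈ D) :
        bernoulliMean (insert a D) (fun A => g (insert z A) - g (A.erase z)) p =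
          p * bernoulliMean D (fun A => g (insert a (insert z A)) - g (insert a (A.erase z))) p +
          (1 - p) * bernoulliMean D (fun A => g (insert z A) - g (A.erase z)) p := by
      have hza : z ≠ a := fun h => ha (h ▸ hz)
      simp only [bernoulliMean_insert ha, Finset.insert_comm z, Finset.erase_insert_of_ne hza.symm]
    rw [Finset.sum_insert ha, hself, Finset.sum_congr rfl hother, Finset.sum_add_distrib,
      Finset.mul_sum, Finset.mul_sum]
    simp only [one_mul, id_eq, zero_sub, neg_mul, Pi.sub_apply]
    ring

end BernoulliMean

section ProductMeasure

variable {ι : Type*} {X : ι → Type*} [∀ i, MeasurableSpace (X i)]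

lemma pi_withDensity [Fintype ι] (μ : ∀ i, Measure (X i)) [∀ i, IsProbabilityMeasure (μ i)]
    {g : ∀ i, X i → ENNReal} (hg : ∀ i, Measurable (g i))
    [∀ i, SigmaFinite ((μ i).withDensity (g i))] :
    Measure.pi (fun i => (μ i).withDensity (g i)) =
      (Measure.pi μ).withDensity fun r => ∏ i, g i (r i) := by
  refine Measure.pi_eq fun s hs => ?_
  have hm (i) : Measurable ((s i).indicator (g i)) := (hg i).indicator (hs i)
  have hind : (Set.univ.pi s).indicator (fun r => ∏ i, g i (r i)) =
      fun r => ∏ i, (s i).indicator (g i) (r i) := by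
    classical
    funext r
    simp only [Set.indicator_apply, Finset.prod_ite_zero, Set.mem_univ_pi, Finset.mem_univ,
      true_implies]
  have hindep := iIndepFun_pi (μ := μ) fun i => (hm i).aemeasurable
  calc ((Measure.pi μ).withDensity fun r => ∏ i, g i (r i)) (Set.univ.pi s)
    _ = ∫⁻ r, ∏ i, (s i).indicator (g i) (r i) ∂Measure.pi μ := by
      rw [withDensity_apply _ (.univ_pi hs), ← lintegral_indicator (.univ_pi hs), hind]
    _ = ∏ i, ∫⁻ r, (s i).indicator (g i) (r i) ∂Measure.pi μ :=
      lintegral_prod_eq_prod_lintegral_of_indepFun Finset.univ _ hindep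
        fun i => (hm i).comp (measurable_pi_apply i)
    _ = ∏ i, (μ i).withDensity (g i) (s i) := Finset.prod_congr rfl fun i _ => by
      rw [(measurePreserving_eval μ i).lintegral_comp (hm i), lintegral_indicator (hs i),
        withDensity_apply _ (hs i)]

variable (μ : ∀ i, Measure (X i)) [∀ i, IsProbabilityMeasure (μ i)]

lemma infinitePi_eq_setLIntegral {ν : ∀ i, Measure (X i)} [∀ i, IsProbabilityMeasure (ν i)]
    {s : Finset ι} {g : ∀ i, X i → ENNReal} (hg : ∀ i, Measurable (g i))
    (hν : ∀ i ∈ s, ν i = (μ i).withDensity (g i)) {E : Set (∀ i, X i)} (hE : MeasurableSet E)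
    (hs : DependsOn (· ∈ E) (s : Set ι)) :
    Measure.infinitePi ν E = ∫⁻ ω in E, ∏ i ∈ s, g i (ω i) ∂Measure.infinitePi μ := by
  classical
  obtain ⟨ω₀⟩ := (Measure.infinitePi μ).nonempty_of_neZero
  set S : Set (∀ i : s, X i) := Function.updateFinset ω₀ s ⁻¹' E
  have hS : MeasurableSet S := measurable_updateFinset hE
  have hES : E = s.restrict ⁻¹' S := by
    ext ω
    exact iff_of_eq (hs fun i hi => by simp_all [Function.updateFinset])
  have hpi : Measure.pi (fun i : s => ν i) =
      (Measure.pi fun i : s => μ i).withDensity fun r => ∏ i : s, g i (r i) := by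
    have hν' : (fun i : s => ν i) = fun i : s => (μ i).withDensity (g i) :=
      funext fun i => hν i i.2
    have (i : s) : SigmaFinite ((μ i).withDensity (g i)) := hν i i.2 ▸ inferInstance
    rw [hν', pi_withDensity _ fun i : s => hg i]
  have hprod : Measurable fun r : (∀ i : s, X i) => ∏ i : s, g i (r i) := by
    fun_prop
  rw [hES, ← Measure.map_apply (Finset.measurable_restrict s) hS, Measure.infinitePi_map_restrict,
    hpi, withDensity_apply _ hS, ← Measure.infinitePi_map_restrict,
    setLIntegral_map hS hprod (Finset.measurable_restrict s)]
  refine lintegral_congr fun ω => Finset.prod_coe_sort s fun i => g i (ω i)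

variable [DecidableEq ι]

lemma measurePreserving_update (j : ι) :
    MeasurePreserving (fun q : (∀ i, X i) × X j => Function.update q.1 j q.2)
      ((Measure.infinitePi μ).prod (μ j)) (Measure.infinitePi μ) := by
  have hm : Measurable fun q : (∀ i, X i) × X j => Function.update q.1 j q.2 :=
    measurable_update'.comp (measurable_fst.prodMk measurable_snd)
  refine ⟨hm, Measure.eq_infinitePi μ fun s t ht => ?_⟩
  have hbox : (fun q : (∀ i, X i) × X j => Function.update q.1 j q.2) ⁻¹' Set.pi s t =
      Set.pi (s.erase j : Finset ι) t ×ˢ {a | j ∈ s → a ∈ t j} := by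
    ext q
    simp only [Set.mem_preimage, Set.mem_pi, Finset.mem_coe, Set.mem_prod, Finset.mem_erase,
      Set.mem_ofPred_eq]
    refine ⟨fun h => ⟨fun i hi => by simpa [hi.1] using h i hi.2,
      fun hj => by simpa using h j hj⟩, fun h i hi => ?_⟩
    obtain rfl | hij := eq_or_ne i j
    · simpa using h.2 hi
    · simpa [hij] using h.1 i ⟨hij, hi⟩
  rw [Measure.map_apply hm (.pi s.countable_toSet fun i _ => ht i), hbox, Measure.prod_prod,
    Measure.infinitePi_pi μ fun i _ => ht i]
  by_cases hj : j ∈ s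
  · simp only [hj, true_imp_iff, Set.ofPred_mem_eq, Finset.prod_erase_mul]
  · simp [hj]

lemma lintegral_infinitePi_update (j : ι) {f : (∀ i, X i) → ENNReal} (hf : Measurable f) :
    ∫⁻ ω, f ω ∂Measure.infinitePi μ =
      ∫⁻ ω, ∫⁻ a, f (Function.update ω j a) ∂μ j ∂Measure.infinitePi μ := by
  rw [← (measurePreserving_update μ j).lintegral_comp hf, lintegral_prod]
  exact (hf.comp (measurePreserving_update μ j).measurable).aemeasurable

/-- The coordinate `j` serves as an independent copy to be added to the coordinate `i`. -/
lemma lintegral_infinitePi_update_add {M : Type*} [AddMonoid M] [MeasurableSpace M]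
    [MeasurableAdd₂ M] (μ : ι → Measure M) [∀ i, IsProbabilityMeasure (μ i)] {i j : ι}
    (hij : i ≠ j) {g : M → ENNReal} (hg : Measurable g)
    (hconv : μ i ∗ μ j = (μ i).withDensity g) {f : (ι → M) → ENNReal} (hf : Measurable f)
    (hfj : ∀ ω a, f (Function.update ω j a) = f ω) :
    ∫⁻ ω, f (Function.update ω i (ω i + ω j)) ∂Measure.infinitePi μ =
      ∫⁻ ω, g (ω i) * f ω ∂Measure.infinitePi μ := by
  have hupd : Measurable fun q : (ι → M) × M => Function.update q.1 i q.2 :=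
    measurable_update'.comp (measurable_fst.prodMk measurable_snd)
  have hfi (ω : ι → M) : Measurable fun c => f (Function.update ω i c) :=
    hf.comp (measurable_update ω)
  have hF : Measurable fun ω : ι → M => f (Function.update ω i (ω i + ω j)) :=
    hf.comp (hupd.comp (f := fun ω : ι → M => (ω, ω i + ω j)) (by fun_prop))
  have hG : Measurable fun ω : ι → M => ∫⁻ b, f (Function.update ω i (ω i + b)) ∂μ j :=
    Measurable.lintegral_prod_right' (f := fun q : (ι → M) × M =>
      f (Function.update q.1 i (q.1 i + q.2)))
      (hf.comp (hupd.comp (f := fun q : (ι → M) × M => (q.1, q.1 i + q.2)) (by fun_prop)))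
  calc ∫⁻ ω, f (Function.update ω i (ω i + ω j)) ∂Measure.infinitePi μ
    _ = ∫⁻ ω, ∫⁻ b, f (Function.update ω i (ω i + b)) ∂μ j ∂Measure.infinitePi μ := by
      rw [lintegral_infinitePi_update μ j hF]
      simp only [Function.update_self, Function.update_of_ne hij,
        Function.update_comm hij.symm, hfj]
    _ = ∫⁻ ω, ∫⁻ a, ∫⁻ b, f (Function.update ω i (a + b)) ∂μ j ∂μ i ∂Measure.infinitePi μ := by
      rw [lintegral_infinitePi_update μ i hG]
      simp only [Function.update_self, Function.update_idem]
    _ = ∫⁻ ω, ∫⁻ c, g c * f (Function.update ω i c) ∂μ i ∂Measure.infinitePi μ := by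
      refine lintegral_congr fun ω => ?_
      rw [← Measure.lintegral_conv (hfi ω), hconv,
        lintegral_withDensity_eq_lintegral_mul _ hg (hfi ω)]
      rfl
    _ = ∫⁻ ω, g (ω i) * f ω ∂Measure.infinitePi μ := by
      rw [lintegral_infinitePi_update μ i (f := fun ω => g (ω i) * f ω) (by fun_prop)]
      simp only [Function.update_self]

end ProductMeasure

/-! ### Exponential variables and the order of arrivals -/

section OrderOfIID

variable {Ω α : Type*} [MeasurableSpace Ω] [LinearOrder α]

lemma perm_eq_of_strictAnti_comp {k : ℕ} {r : Fin k → α} {σ τ : Equiv.Perm (Fin k)}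
    (hσ : StrictAnti (r ∘ σ)) (hτ : StrictAnti (r ∘ τ)) : σ = τ := by
  have hmono : StrictMono (σ⁻¹ * τ) := fun i j hij => hσ.lt_iff_gt.1 (by simpa using hτ hij)
  have hid : ⇑(σ⁻¹ * τ) = id := (hmono.range_inj strictMono_id).1 (by simp)
  exact inv_mul_eq_one.1 (DFunLike.coe_injective hid)

lemma measure_strictAnti_le [TopologicalSpace α] [OrderClosedTopology α]
    [SecondCountableTopology α] [MeasurableSpace α] [OpensMeasurableSpace α] {μ : Measure Ω}
    {k : ℕ} {X : Fin k → Ω → α} (hX : ∀ i, Measurable (X i)) (hindep : iIndepFun X μ)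
    (hident : ∀ i j, IdentDistrib (X i) (X j) μ μ) :
    μ {ω | StrictAnti (X · ω)} ≤ (k.factorial : ENNReal)⁻¹ := by
  have := hindep.isProbabilityMeasure
  have hA : MeasurableSet {r : Fin k → α | StrictAnti r} := by
    simp only [StrictAnti, Set.ofPred_forall]
    exact .iInter fun a => .iInter fun b => .iInter fun _ =>
      measurableSet_lt (measurable_pi_apply _) (measurable_pi_apply _)
  have hperm (σ : Equiv.Perm (Fin k)) :
      μ {ω | StrictAnti ((X · ω) ∘ σ)} = μ {ω | StrictAnti (X · ω)} :=
    (IdentDistrib.pi (fun i => hident (σ i) i) (hindep.precomp σ.injective)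
      hindep).measure_mem_eq hA
  have hdisj : Pairwise (Function.onFun Disjoint fun σ : Equiv.Perm (Fin k) =>
      {ω | StrictAnti ((X · ω) ∘ σ)}) := fun σ τ hστ =>
    Set.disjoint_left.2 fun ω hσ hτ => hστ (perm_eq_of_strictAnti_comp hσ hτ)
  have hsum : (k.factorial : ENNReal) * μ {ω | StrictAnti (X · ω)} ≤ 1 := by
    calc (k.factorial : ENNReal) * μ {ω | StrictAnti (X · ω)}
      _ = ∑ σ : Equiv.Perm (Fin k), μ {ω | StrictAnti ((X · ω) ∘ σ)} := by
        simp [hperm, Fintype.card_perm]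
      _ = μ (⋃ σ : Equiv.Perm (Fin k), {ω | StrictAnti ((X · ω) ∘ σ)}) := by
        rw [← tsum_fintype (L := .unconditional _), measure_iUnion hdisj fun σ =>
          (measurable_pi_lambda _ fun i => hX (σ i)) hA]
      _ ≤ 1 := prob_le_one
  rwa [ENNReal.le_inv_iff_mul_le, mul_comm]

end OrderOfIID

section Exponential

lemma measurable_exponentialPDF (r : ℝ) : Measurable (exponentialPDF r) :=
  (measurable_exponentialPDFReal r).ennreal_ofReal

lemma expMeasure_eq_withDensity_expMeasure {l r : ℝ} (hl : 0 < l) (hr : 0 < r) :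
    expMeasure l =
      (expMeasure r).withDensity fun s => ENNReal.ofReal (l / r * Real.exp ((r - l) * s)) := by
  refine Eq.trans ?_ (withDensity_mul volume (measurable_exponentialPDF r) (by fun_prop))
  refine congrArg volume.withDensity (funext fun s => ?_)
  change exponentialPDF l s = exponentialPDF r s * _
  rw [exponentialPDF_eq, exponentialPDF_eq]
  split_ifs
  · rw [← ENNReal.ofReal_mul (by positivity)]
    congr 1
    have hexp : Real.exp (-(l * s)) = Real.exp (-(r * s)) * Real.exp ((r - l) * s) := by
      rw [← Real.exp_add]
      ring_nf
    rw [hexp]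
    field_simp
  · simp

lemma ae_nonneg_expMeasure (r : ℝ) : ∀ᵐ a ∂expMeasure r, 0 ≤ a := by
  refine (ae_withDensity_iff (measurable_exponentialPDF r)).2 (.of_forall fun a ha => ?_)
  contrapose! ha
  exact exponentialPDF_of_neg ha

open scoped MeasureTheory in
lemma lconvolution_exponentialPDF {r : ℝ} (hr : 0 < r) (s : ℝ) :
    (exponentialPDF r ⋆ₗ exponentialPDF r) s = exponentialPDF r s * ENNReal.ofReal (r * s) := by
  have hind (a : ℝ) : exponentialPDF r a * exponentialPDF r (-a + s) =
      (Set.Icc 0 s).indicator (fun _ => ENNReal.ofReal (r * r * Real.exp (-(r * s)))) a := by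
    by_cases ha : a ∈ Set.Icc 0 s
    · rw [Set.indicator_of_mem ha, exponentialPDF_of_nonneg ha.1,
        exponentialPDF_of_nonneg (by linarith [ha.2]), ← ENNReal.ofReal_mul (by positivity),
        mul_mul_mul_comm, ← Real.exp_add]
      ring_nf
    · rw [Set.indicator_of_notMem ha, mul_eq_zero]
      refine (not_and_or.1 ha).imp (fun h => exponentialPDF_of_neg (not_le.1 h))
        fun h => exponentialPDF_of_neg (by linarith)
  rw [lconvolution_def]
  simp only [hind]
  rw [lintegral_indicator measurableSet_Icc, setLIntegral_const, Real.volume_Icc, sub_zero]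
  obtain hs | hs := le_or_gt 0 s
  · rw [exponentialPDF_of_nonneg hs, ← ENNReal.ofReal_mul (by positivity),
      ← ENNReal.ofReal_mul (by positivity)]
    ring_nf
  · rw [exponentialPDF_of_neg hs, ENNReal.ofReal_of_nonpos hs.le]
    simp

/-- The sum of two independent exponential variables is size-biased exponential. -/
lemma expMeasure_conv_self {r : ℝ} (hr : 0 < r) :
    expMeasure r ∗ expMeasure r =
      (expMeasure r).withDensity fun s => ENNReal.ofReal (r * s) := by
  have hm := measurable_exponentialPDF r
  calc expMeasure r ∗ expMeasure r
    _ = volume.withDensity (exponentialPDF r ⋆ₗ exponentialPDF r) :=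
      conv_withDensity_eq_lconvolution hm hm
    _ = volume.withDensity (exponentialPDF r * fun s => ENNReal.ofReal (r * s)) := by
      rw [funext (lconvolution_exponentialPDF hr)]
      rfl
    _ = (expMeasure r).withDensity fun s => ENNReal.ofReal (r * s) :=
      withDensity_mul _ hm (by fun_prop)

end Exponential

/-! ### The law of the gaps and its dependence on the rate -/

section Gaps

lemma rate_pos {lam : ℝ} (hlam : 0 < lam) (x : Site) : 0 < rate lam x := by
  unfold rate
  split_ifs
  exacts [hlam, one_pos]

lemma rate_of_evenSite (lam : ℝ) {x : Site} (hx : EvenSite x) : rate lam x = lam := if_pos hx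

lemma rate_of_not_evenSite (lam : ℝ) {x : Site} (hx : ¬ EvenSite x) : rate lam x = 1 := if_neg hx

/-- The law of the gaps between consecutive arrivals. -/
noncomputable abbrev gapLaw (lam : ℝ) : Measure (Site × ℕ → ℝ) :=
  Measure.infinitePi fun i => expMeasure (rate lam i.1)

instance (lam : ℝ) [hlam : Fact (0 < lam)] (x : Site) :
    IsProbabilityMeasure (expMeasure (rate lam x)) :=
  isProbabilityMeasure_expMeasure (rate_pos hlam.out x)

/-- The first arrival times, as a function of the gaps. -/
def firstTimes (g : Site × ℕ → ℝ) (x : Site) : ℝ := g (x, 0)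

/-- The first arrival times, but with the second arrival time at the site `x`. -/
def delayedTimes (x : Site) (g : Site × ℕ → ℝ) : Site → ℝ :=
  Function.update (firstTimes g) x (g (x, 0) + g (x, 1))

lemma delayedTimes_eq_firstTimes_update (x : Site) (g : Site × ℕ → ℝ) :
    delayedTimes x g = firstTimes (Function.update g (x, 0) (g (x, 0) + g (x, 1))) := by
  funext y
  obtain rfl | hy := eq_or_ne y x <;> simp [delayedTimes, firstTimes, *]

lemma measurable_firstTimes : Measurable firstTimes :=
  measurable_pi_lambda _ fun _ => measurable_pi_apply _

lemma measurable_delayedTimes (x : Site) : Measurable (delayedTimes x) :=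
  measurable_update'.comp (measurable_firstTimes.prodMk (by fun_prop))

lemma ae_nonneg_gap (lam : ℝ) [Fact (0 < lam)] (i : Site × ℕ) : ∀ᵐ g ∂gapLaw lam, 0 ≤ g i :=
  (measurePreserving_eval_infinitePi (fun i : Site × ℕ => expMeasure (rate lam i.1))
    i).quasiMeasurePreserving.ae (ae_nonneg_expMeasure _)

lemma gapLaw_delayedTimes (lam : ℝ) [hlam : Fact (0 < lam)] (x : Site) {F : Set (Site → ℝ)}
    (hF : MeasurableSet F) :
    gapLaw lam (delayedTimes x ⁻¹' F) =
      ∫⁻ g in firstTimes ⁻¹' F, ENNReal.ofReal (rate lam x * g (x, 0)) ∂gapLaw lam := by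
  classical
  have hE := measurable_firstTimes hF
  have hself (g : Site × ℕ → ℝ) (a : ℝ) : firstTimes (Function.update g (x, 1) a) = firstTimes g :=
    funext fun y => by simp [firstTimes]
  calc gapLaw lam (delayedTimes x ⁻¹' F)
    _ = ∫⁻ g, (firstTimes ⁻¹' F).indicator 1
          (Function.update g (x, 0) (g (x, 0) + g (x, 1))) ∂gapLaw lam := by
      rw [← lintegral_indicator_one (measurable_delayedTimes x hF)]
      simp only [Set.indicator_apply, Set.mem_preimage, delayedTimes_eq_firstTimes_update]
      rfl
    _ = ∫⁻ g, ENNReal.ofReal (rate lam x * g (x, 0)) *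
          (firstTimes ⁻¹' F).indicator 1 g ∂gapLaw lam :=
      lintegral_infinitePi_update_add _ (i := (x, 0)) (j := (x, 1)) (by simp)
        (g := fun s => ENNReal.ofReal (rate lam x * s)) (by fun_prop)
        (expMeasure_conv_self (rate_pos hlam.out x)) (measurable_one.indicator hE)
        fun g a => by simp only [Set.indicator_apply, Set.mem_preimage, hself, Pi.one_apply]
    _ = ∫⁻ g in firstTimes ⁻¹' F, ENNReal.ofReal (rate lam x * g (x, 0)) ∂gapLaw lam := by
      rw [← lintegral_indicator hE]
      simp only [Set.indicator, mul_ite, Pi.one_apply, mul_one, mul_zero]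

lemma integrable_gap (lam : ℝ) [hlam : Fact (0 < lam)] (x : Site) :
    Integrable (fun g => g (x, 0)) (gapLaw lam) := by
  have hpos := rate_pos hlam.out x
  refine (integrable_const_mul_iff hpos.ne'.isUnit _).1
    ((lintegral_ofReal_ne_top_iff_integrable
      (by fun_prop : Measurable _).aestronglyMeasurable ?_).1 ?_)
  · filter_upwards [ae_nonneg_gap lam (x, 0)] with g hg using mul_nonneg hpos.le hg
  · rw [← setLIntegral_univ, ← Set.preimage_univ (f := firstTimes),
      ← gapLaw_delayedTimes lam x .univ]
    exact measure_ne_top _ _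

/-- Weighting an event with a first arrival time amounts to delaying that arrival. -/
lemma setIntegral_gap (lam : ℝ) [hlam : Fact (0 < lam)] (x : Site) {F : Set (Site → ℝ)}
    (hF : MeasurableSet F) :
    ∫ g in firstTimes ⁻¹' F, g (x, 0) ∂gapLaw lam =
      (gapLaw lam).real (delayedTimes x ⁻¹' F) / rate lam x := by
  have hpos := rate_pos hlam.out x
  rw [eq_div_iff hpos.ne', mul_comm, measureReal_def, gapLaw_delayedTimes lam x hF,
    ← integral_const_mul, integral_eq_lintegral_of_nonneg_ae _
      (by fun_prop : Measurable _).aestronglyMeasurable]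
  filter_upwards [ae_restrict_of_ae (ae_nonneg_gap lam (x, 0))] with g hg
    using mul_nonneg hpos.le hg

end Gaps

section Rates

open Classical in
/-- The even sites of `S`. -/
noncomputable def evenSites (S : Finset Site) : Finset Site := S.filter EvenSite

lemma mem_evenSites {S : Finset Site} {x : Site} : x ∈ evenSites S ↔ x ∈ S ∧ EvenSite x := by
  simp [evenSites]

/-- The total of the first arrival times at the even sites of `S`. -/
noncomputable def evenTotal (S : Finset Site) (g : Site × ℕ → ℝ) : ℝ :=
  ∑ x ∈ evenSites S, g (x, 0)

@[fun_prop]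
lemma measurable_evenTotal (S : Finset Site) : Measurable (evenTotal S) := by
  unfold evenTotal
  fun_prop

lemma prod_rate_div_rate_mul_exp (S : Finset Site) {lam r : ℝ} (g : Site × ℕ → ℝ) :
    ∏ x ∈ S, rate lam x / rate r x * Real.exp ((rate r x - rate lam x) * g (x, 0)) =
      (lam / r) ^ (evenSites S).card * Real.exp ((r - lam) * evenTotal S g) := by
  rw [evenTotal, evenSites, Finset.mul_sum, Real.exp_sum, ← Finset.prod_const,
    ← Finset.prod_mul_distrib, Finset.prod_filter]
  refine Finset.prod_congr rfl fun x _ => ?_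
  split_ifs with hx
  · rw [rate_of_evenSite _ hx, rate_of_evenSite _ hx]
  · rw [rate_of_not_evenSite _ hx, rate_of_not_evenSite _ hx]
    simp

lemma gapLaw_apply_eq_setLIntegral {S : Finset Site} {lam r : ℝ} (hlam : 0 < lam) (hr : 0 < r)
    {F : Set (Site → ℝ)} (hF : MeasurableSet F) (hS : DependsOn (· ∈ F) (S : Set Site)) :
    gapLaw lam (firstTimes ⁻¹' F) = ∫⁻ g in firstTimes ⁻¹' F, ENNReal.ofReal
      ((lam / r) ^ (evenSites S).card * Real.exp ((r - lam) * evenTotal S g)) ∂gapLaw r := by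
  have : Fact (0 < lam) := ⟨hlam⟩
  have : Fact (0 < r) := ⟨hr⟩
  have hdep : DependsOn (· ∈ firstTimes ⁻¹' F) ((S ×ˢ {0} : Finset (Site × ℕ)) : Set (Site × ℕ)) :=
    fun g g' h => hS fun x hx => h (x, 0) (by simpa using hx)
  rw [infinitePi_eq_setLIntegral (fun i : Site × ℕ => expMeasure (rate r i.1)) (by fun_prop)
    (fun i _ => expMeasure_eq_withDensity_expMeasure (rate_pos hlam i.1) (rate_pos hr i.1))
    (measurable_firstTimes hF) hdep]
  refine lintegral_congr fun g => ?_
  rw [Finset.prod_product, ← prod_rate_div_rate_mul_exp, ENNReal.ofReal_prod_of_nonneg]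
  · simp only [Finset.prod_singleton]
  · intro x _
    have := rate_pos hlam x
    have := rate_pos hr x
    positivity

lemma integrable_exp_evenTotal (S : Finset Site) {r u : ℝ} (hr : 0 < r) (hu : u < r) :
    Integrable (fun g => Real.exp (u * evenTotal S g)) (gapLaw r) := by
  have : Fact (0 < r) := ⟨hr⟩
  have hlam : 0 < r - u := sub_pos.2 hu
  have : Fact (0 < r - u) := ⟨hlam⟩
  have hc : ((r - u) / r) ^ (evenSites S).card ≠ 0 := by positivity
  refine (integrable_const_mul_iff hc.isUnit _).1
    ((lintegral_ofReal_ne_top_iff_integrable (by fun_prop) (.of_forall fun g => ?_)).1 ?_)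
  · positivity
  · have h := gapLaw_apply_eq_setLIntegral (S := S) hlam hr .univ (fun _ _ _ => rfl)
    rw [Set.preimage_univ, setLIntegral_univ, measure_univ, sub_sub_cancel] at h
    exact h ▸ ENNReal.one_ne_top

lemma hasDerivAt_gapLaw_real {S : Finset Site} {r : ℝ} (hr : 0 < r) {F : Set (Site → ℝ)}
    (hF : MeasurableSet F) (hS : DependsOn (· ∈ F) (S : Set Site)) :
    HasDerivAt (fun lam => (gapLaw lam).real (firstTimes ⁻¹' F))
      ((evenSites S).card / r * (gapLaw r).real (firstTimes ⁻¹' F) -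
        ∫ g in firstTimes ⁻¹' F, evenTotal S g ∂gapLaw r) r := by
  have : Fact (0 < r) := ⟨hr⟩
  set ρ := (gapLaw r).restrict (firstTimes ⁻¹' F) with hρ
  have hval {lam : ℝ} (hlam : 0 < lam) : (gapLaw lam).real (firstTimes ⁻¹' F) =
      (lam / r) ^ (evenSites S).card * mgf (evenTotal S) ρ (r - lam) := by
    rw [measureReal_def, gapLaw_apply_eq_setLIntegral hlam hr hF hS, mgf, ← integral_const_mul,
      integral_eq_lintegral_of_nonneg_ae (.of_forall fun g => by positivity) (by fun_prop)]
  have hmem : (0 : ℝ) ∈ interior (integrableExpSet (evenTotal S) ρ) :=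
    mem_interior.2 ⟨Set.Iio r, fun u hu => (integrable_exp_evenTotal S hr hu).restrict,
      isOpen_Iio, hr⟩
  have hmgf : HasDerivAt (fun lam => mgf (evenTotal S) ρ (r - lam))
      (-∫ g, evenTotal S g ∂ρ) r := by
    have h := hasDerivAt_mgf hmem
    simp only [zero_mul, Real.exp_zero, mul_one] at h
    rw [← sub_self r] at h
    exact (h.comp r ((hasDerivAt_id r).const_sub r)).congr_deriv (by simp)
  have hpow : HasDerivAt (fun lam : ℝ => (lam / r) ^ (evenSites S).card)
      ((evenSites S).card / r) r :=
    (((hasDerivAt_id r).div_const r).pow _).congr_deriv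
      (by simp [div_self hr.ne', div_eq_mul_inv])
  have hzero : mgf (evenTotal S) ρ 0 = (gapLaw r).real (firstTimes ⁻¹' F) := by
    simp [hρ, measureReal_def]
  refine ((hpow.mul hmgf).congr_of_eventuallyEq ?_).congr_deriv ?_
  · filter_upwards [lt_mem_nhds hr] with lam hlam using hval hlam
  · rw [sub_self, hzero, div_self hr.ne', one_pow, one_mul, ← sub_eq_add_neg]

/-- The effect of delaying the arrival at `x` on the probability of the event `F`. -/
noncomputable def influence (F : Set (Site → ℝ)) (lam : ℝ) (x : Site) : ℝ :=
  (gapLaw lam).real (firstTimes ⁻¹' F) - (gapLaw lam).real (delayedTimes x ⁻¹' F)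

lemma influence_eq_zero {S : Finset Site} {F : Set (Site → ℝ)}
    (hS : DependsOn (· ∈ F) (S : Set Site)) (lam : ℝ) {x : Site} (hx : x ∉ S) :
    influence F lam x = 0 := by
  have : delayedTimes x ⁻¹' F = firstTimes ⁻¹' F := by
    ext g
    refine iff_of_eq (hS fun y hy => Function.update_of_ne ?_ _ _)
    rintro rfl
    exact hx hy
  rw [influence, this, sub_self]

lemma hasDerivAt_gapLaw_real_influence {S : Finset Site} {r : ℝ} (hr : 0 < r)
    {F : Set (Site → ℝ)} (hF : MeasurableSet F) (hS : DependsOn (· ∈ F) (S : Set Site)) :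
    HasDerivAt (fun lam => (gapLaw lam).real (firstTimes ⁻¹' F))
      (1 / r * ∑ x ∈ evenSites S, influence F r x) r := by
  have : Fact (0 < r) := ⟨hr⟩
  refine (hasDerivAt_gapLaw_real hr hF hS).congr_deriv ?_
  have hsum : ∫ g in firstTimes ⁻¹' F, evenTotal S g ∂gapLaw r =
      ∑ x ∈ evenSites S, (gapLaw r).real (delayedTimes x ⁻¹' F) / r := by
    simp only [evenTotal]
    rw [integral_finsetSum _ fun x _ => (integrable_gap r x).restrict]
    refine Finset.sum_congr rfl fun x hx => ?_
    rw [setIntegral_gap r x hF, rate_of_evenSite r (mem_evenSites.1 hx).2]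
  simp only [hsum, influence, Finset.sum_sub_distrib, Finset.sum_const, nsmul_eq_mul,
    ← Finset.sum_div]
  ring

end Rates

/-! ### Local approximation -/

section Events

open Classical in
/-- The black sites of `[-n, n] × [-n, n]`. -/
noncomputable def blackSites (n : ℕ) (t : Site → ℝ) : Finset Site := (square n).filter (BlackSite t)

open Classical in
/-- The sites of `[-n, n] × [-n, n]` that are seen to be black within `k` generations. -/
noncomputable def blackSitesBy (k n : ℕ) (t : Site → ℝ) : Finset Site :=
  (square n).filter (BlackBy t k)

lemma mem_blackSites {n : ℕ} {t : Site → ℝ} {x : Site} :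
    x ∈ blackSites n t ↔ x ∈ square n ∧ BlackSite t x := by
  simp [blackSites]

lemma mem_blackSitesBy {k n : ℕ} {t : Site → ℝ} {x : Site} :
    x ∈ blackSitesBy k n t ↔ x ∈ square n ∧ BlackBy t k x := by
  simp [blackSitesBy]

lemma blackSitesBy_subset_blackSites (k n : ℕ) (t : Site → ℝ) :
    blackSitesBy k n t ⊆ blackSites n t := fun _ hx =>
  mem_blackSites.2 ((mem_blackSitesBy.1 hx).imp_right BlackBy.blackSite)

lemma blackSitesBy_congr {k n : ℕ} {t t' : Site → ℝ} (ht : ∀ y ∈ square (n + k), t y = t' y) :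
    blackSitesBy k n t = blackSitesBy k n t' := by
  ext x
  rw [mem_blackSitesBy, mem_blackSitesBy]
  exact and_congr_right fun hx => blackBy_congr hx ht

lemma measurableSet_blackBy (k : ℕ) (x : Site) : MeasurableSet {t : Site → ℝ | BlackBy t k x} := by
  induction k generalizing x with
  | zero => exact .const False
  | succ k ih =>
    have hlt (y : Site) : Measurable fun t : Site → ℝ => t y < t x :=
      measurableSet_setOfPred.1 (measurableSet_lt (measurable_pi_apply y) (measurable_pi_apply x))
    have hby (y : Site) : Measurable fun t : Site → ℝ => BlackBy t k y :=
      measurableSet_setOfPred.1 (ih y)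
    exact measurableSet_setOfPred.2
      ((measurable_const.and (.forall fun y => measurable_const.imp ((hlt y).imp (hby y)))).or
        (measurable_const.and (.exists fun y => measurable_const.and ((hlt y).and (hby y)))))

lemma measurableSet_blackSite (x : Site) : MeasurableSet {t : Site → ℝ | BlackSite t x} := by
  have : {t : Site → ℝ | BlackSite t x} = ⋃ k, {t | BlackBy t k x} :=
    Set.ext fun t => ⟨fun h => Set.mem_iUnion.2 h.exists_blackBy,
      fun h => (Set.mem_iUnion.1 h).elim fun _ => BlackBy.blackSite⟩
  exact this ▸ .iUnion fun k => measurableSet_blackBy k x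

/-- The event that the set of black sites of `[-n, n] × [-n, n]` has the property `Φ`. -/
def blackEvent (n : ℕ) (Φ : Finset Site → Prop) : Set (Site → ℝ) := {t | Φ (blackSites n t)}

/-- The event that the sites seen to be black within `k` generations have the property `Φ`; it is
a local approximation of `blackEvent n Φ`. -/
def blackEventBy (k n : ℕ) (Φ : Finset Site → Prop) : Set (Site → ℝ) :=
  {t | Φ (blackSitesBy k n t)}

lemma measurableSet_blackEvent (n : ℕ) (Φ : Finset Site → Prop) :
    MeasurableSet (blackEvent n Φ) :=
  measurableSet_filter measurableSet_blackSite Φ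

lemma measurableSet_blackEventBy (k n : ℕ) (Φ : Finset Site → Prop) :
    MeasurableSet (blackEventBy k n Φ) :=
  measurableSet_filter (measurableSet_blackBy k) Φ

lemma dependsOn_blackEventBy (k n : ℕ) (Φ : Finset Site → Prop) :
    DependsOn (· ∈ blackEventBy k n Φ) (square (n + k) : Set Site) :=
  fun _ _ ht => congrArg Φ (blackSitesBy_congr ht)

lemma blackEventBy_subset_blackEvent (k n : ℕ) {Φ : Finset Site → Prop} (hΦ : Monotone Φ) :
    blackEventBy k n Φ ⊆ blackEvent n Φ :=
  fun t => hΦ (blackSitesBy_subset_blackSites k n t)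

end Events

section LongChains

/-- Arrival times decrease along a walk of `m` double steps between odd sites, starting in
`[-(n + 1), n + 1] × [-(n + 1), n + 1]`. -/
def LongChain (n m : ℕ) (t : Site → ℝ) : Prop :=
  ∃ y ∈ square (n + 1), ¬ EvenSite y ∧ ∃ c ∈ walks twoSteps m y, StrictAnti (t ∘ c)

lemma LongChain.congr {n m : ℕ} {t t' : Site → ℝ} (ht : ∀ x, ¬ EvenSite x → t x = t' x)
    (h : LongChain n m t) : LongChain n m t' := by
  obtain ⟨y, hy, ho, c, hc, ha⟩ := h
  have : t ∘ c = t' ∘ c := funext fun i => ht _ ((evenSite_iff_of_mem_walks hc i).not.2 ho)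
  exact ⟨y, hy, ho, c, hc, this ▸ ha⟩

lemma longChain_of_mem_sdiff {n m : ℕ} {Φ : Finset Site → Prop} {t : Site → ℝ}
    (ht : t ∈ blackEvent n Φ \ blackEventBy (2 * m + 1) n Φ) : LongChain n m t := by
  obtain ⟨x, hx, hx'⟩ : ∃ x ∈ blackSites n t, x ∉ blackSitesBy (2 * m + 1) n t := by
    by_contra! hle
    have heq := (blackSitesBy_subset_blackSites _ n t).antisymm hle
    exact ht.2 (heq ▸ ht.1 : Φ (blackSitesBy (2 * m + 1) n t))
  rw [mem_blackSites] at hx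
  exact hx.2.exists_odd_strictAnti hx.1 fun hk => hx' (mem_blackSitesBy.2 ⟨hx.1, hk⟩)

lemma measureReal_strictAnti_walk_le (lam : ℝ) [Fact (0 < lam)] {m : ℕ} {y : Site}
    (hy : ¬ EvenSite y) {c : Fin (m + 1) → Site} (hc : c ∈ walks twoSteps m y) :
    (gapLaw lam).real {g | StrictAnti (firstTimes g ∘ c)} ≤ ((m + 1).factorial : ℝ)⁻¹ := by
  by_cases hinj : Function.Injective c
  · have hident (i j : Fin (m + 1)) : IdentDistrib (fun g : Site × ℕ → ℝ => g (c i, 0))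
        (fun g => g (c j, 0)) (gapLaw lam) (gapLaw lam) := by
      refine ⟨(measurable_pi_apply _).aemeasurable, (measurable_pi_apply _).aemeasurable, ?_⟩
      have hrate (i : Fin (m + 1)) : rate lam (c i) = 1 :=
        rate_of_not_evenSite lam ((evenSite_iff_of_mem_walks hc i).not.2 hy)
      rw [gapLaw, (measurePreserving_eval_infinitePi _ (c i, 0)).map_eq,
        (measurePreserving_eval_infinitePi _ (c j, 0)).map_eq, hrate, hrate]
    have hindep : iIndepFun (fun i (g : Site × ℕ → ℝ) => g (c i, 0)) (gapLaw lam) :=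
      (iIndepFun_infinitePi (P := fun i : Site × ℕ => expMeasure (rate lam i.1))
        (X := fun _ s => s) fun _ => measurable_id).precomp
        (g := fun i => (c i, 0)) fun i j h => hinj (Prod.mk.inj h).1
    have hle := measure_strictAnti_le (fun i => measurable_pi_apply (c i, 0)) hindep hident
    exact (ENNReal.toReal_mono (by simp [Nat.factorial_ne_zero]) hle).trans_eq (by simp)
  · have : {g | StrictAnti (firstTimes g ∘ c)} = ∅ :=
      Set.eq_empty_of_forall_notMem fun g hg => hinj (StrictAnti.injective hg).of_comp
    rw [this, measureReal_empty]
    positivity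

lemma pow_div_factorial_succ_le (m : ℕ) :
    (16 : ℝ) ^ m / (m + 1).factorial ≤ Real.exp 4096 * (1 / 256) ^ m :=
  calc (16 : ℝ) ^ m / (m + 1).factorial
    _ ≤ 16 ^ m / m.factorial := by
      gcongr
      exact m.le_succ
    _ = 4096 ^ m / m.factorial * (1 / 256) ^ m := by
      rw [div_mul_eq_mul_div, ← mul_pow]
      norm_num
    _ ≤ Real.exp 4096 * (1 / 256) ^ m := by
      gcongr
      exact Real.pow_div_factorial_le_exp (x := 4096) (by norm_num) m

/-- The constant in the exponential bound for long chains. -/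
noncomputable def chainConst (n : ℕ) : ℝ := (square (n + 1)).card * Real.exp 4096

lemma chainConst_nonneg (n : ℕ) : 0 ≤ chainConst n := by
  unfold chainConst
  positivity

/-- There are at most `16 ^ m` walks of `m` double steps from a site, and the probability that
arrival times decrease along one of them is `1 / (m + 1)!`, whatever the rate at even sites. -/
lemma measureReal_longChain_le (n m : ℕ) (lam : ℝ) [Fact (0 < lam)] :
    (gapLaw lam).real {g | LongChain n m (firstTimes g)} ≤ chainConst n * (1 / 256) ^ m := by
  classical
  have hunion : {g | LongChain n m (firstTimes g)} ⊆
      ⋃ y ∈ (square (n + 1)).filter (¬ EvenSite ·), ⋃ c ∈ walks twoSteps m y,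
        {g | StrictAnti (firstTimes g ∘ c)} := by
    rintro g ⟨y, hy, ho, c, hc, h⟩
    simp only [Set.mem_iUnion]
    exact ⟨y, Finset.mem_filter.2 ⟨hy, ho⟩, c, hc, h⟩
  have hwalks : ∀ y ∈ (square (n + 1)).filter (¬ EvenSite ·),
      (gapLaw lam).real (⋃ c ∈ walks twoSteps m y, {g | StrictAnti (firstTimes g ∘ c)}) ≤
        Real.exp 4096 * (1 / 256) ^ m := fun y hy =>
    calc (gapLaw lam).real (⋃ c ∈ walks twoSteps m y, {g | StrictAnti (firstTimes g ∘ c)})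
      _ ≤ ∑ c ∈ walks twoSteps m y, (gapLaw lam).real {g | StrictAnti (firstTimes g ∘ c)} :=
        measureReal_biUnion_finset_le _ _
      _ ≤ (walks twoSteps m y).card • ((m + 1).factorial : ℝ)⁻¹ :=
        Finset.sum_le_card_nsmul _ _ _ fun c hc =>
          measureReal_strictAnti_walk_le lam (Finset.mem_filter.1 hy).2 hc
      _ ≤ 16 ^ m / (m + 1).factorial := by
        rw [nsmul_eq_mul, ← div_eq_mul_inv]
        gcongr
        exact_mod_cast card_walks_le card_twoSteps_le m y
      _ ≤ Real.exp 4096 * (1 / 256) ^ m := pow_div_factorial_succ_le m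
  calc (gapLaw lam).real {g | LongChain n m (firstTimes g)}
    _ ≤ ∑ y ∈ (square (n + 1)).filter (¬ EvenSite ·),
        (gapLaw lam).real (⋃ c ∈ walks twoSteps m y, {g | StrictAnti (firstTimes g ∘ c)}) :=
      (measureReal_mono hunion (measure_ne_top _ _)).trans (measureReal_biUnion_finset_le _ _)
    _ ≤ ((square (n + 1)).filter (¬ EvenSite ·)).card • (Real.exp 4096 * (1 / 256) ^ m) :=
      Finset.sum_le_card_nsmul _ _ _ hwalks
    _ ≤ chainConst n * (1 / 256) ^ m := by
      rw [nsmul_eq_mul, chainConst, mul_assoc]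
      gcongr
      exact Finset.filter_subset _ _

end LongChains

section Limit

variable {n : ℕ} {Φ : Finset Site → Prop} (hΦ : Monotone Φ) (lam : ℝ) [Fact (0 < lam)]
include hΦ

lemma abs_measureReal_blackEvent_sub_le (j : ℕ) {τ : (Site × ℕ → ℝ) → Site → ℝ}
    (hτ : Measurable τ) (hodd : ∀ g x, ¬ EvenSite x → τ g x = firstTimes g x) :
    |(gapLaw lam).real (τ ⁻¹' blackEvent n Φ) -
      (gapLaw lam).real (τ ⁻¹' blackEventBy (2 * j + 1) n Φ)| ≤ chainConst n * (1 / 256) ^ j := by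
  rw [← measureReal_sdiff (Set.preimage_mono (blackEventBy_subset_blackEvent _ n hΦ))
    (hτ (measurableSet_blackEventBy _ n Φ)), abs_of_nonneg measureReal_nonneg]
  refine (measureReal_mono (fun g hg => ?_)).trans (measureReal_longChain_le n j lam)
  exact (longChain_of_mem_sdiff hg).congr (hodd g)

lemma abs_influence_sub_le (j : ℕ) {x : Site} (hx : EvenSite x) :
    |influence (blackEventBy (2 * j + 1) n Φ) lam x - influence (blackEvent n Φ) lam x| ≤
      2 * chainConst n * (1 / 256) ^ j := by
  have h₁ := abs_measureReal_blackEvent_sub_le (n := n) hΦ lam j measurable_firstTimes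
    fun _ _ _ => rfl
  have h₂ := abs_measureReal_blackEvent_sub_le (n := n) hΦ lam j (measurable_delayedTimes x)
    fun g y hy => Function.update_of_ne (by rintro rfl; exact hy hx) _ _
  rw [abs_sub_comm, influence, influence, sub_sub_sub_comm, mul_assoc,
    two_mul (_ * _)]
  exact (abs_sub _ _).trans (add_le_add h₁ h₂)

end Limit

section Weight

/-- A summable weight on the sites. -/
noncomputable def weight (x : Site) : ℝ := (1 / 2) ^ x.1.natAbs * (1 / 2) ^ x.2.natAbs

lemma summable_weight : Summable weight := by
  have h : Summable fun a : ℤ => (1 / 2 : ℝ) ^ a.natAbs :=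
    .of_nat_of_neg (by simpa using summable_geometric_two) (by simpa using summable_geometric_two)
  exact h.mul_of_nonneg h (fun _ => by positivity) fun _ => by positivity

lemma pow_le_weight {n i : ℕ} {x : Site} (hx : x ∈ square (n + (2 * i + 3))) :
    (1 / 16 : ℝ) ^ i ≤ 4 ^ (n + 3) * weight x := by
  rw [mem_square] at hx
  have hpow {a : ℕ} (ha : a ≤ n + (2 * i + 3)) : (1 / 2 : ℝ) ^ (n + (2 * i + 3)) ≤ (1 / 2) ^ a :=
    pow_le_pow_of_le_one (by norm_num) (by norm_num) ha
  calc (1 / 16 : ℝ) ^ i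
    _ = 4 ^ (n + 3) * ((1 / 2) ^ (n + (2 * i + 3)) * (1 / 2) ^ (n + (2 * i + 3))) := by
      rw [← mul_pow, show n + (2 * i + 3) = n + 3 + 2 * i by ring, pow_add _ (n + 3), ← mul_assoc,
        ← mul_pow, pow_mul]
      norm_num
    _ ≤ 4 ^ (n + 3) * weight x := by
      unfold weight
      gcongr ?_ * (?_ * ?_)
      · exact hpow (by omega)
      · exact hpow (by omega)

/-- If `x` is outside the `j`-th square, then `a j x` may be replaced by `a i x`, where the `i`-th
square is the last one not containing `x`: this gains decay in `x`. -/
lemma abs_sub_le_weight {n : ℕ} {C : ℝ} (hC : 0 ≤ C) {a : ℕ → ℝ} {b : ℝ} {x : Site}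
    (ha : ∀ i, x ∉ square (n + (2 * i + 1)) → a i = 0)
    (hab : ∀ i, |a i - b| ≤ C * (1 / 256) ^ i) (j : ℕ) :
    |a j - b| ≤ C * 4 ^ (n + 3) * (1 / 16) ^ j * weight x := by
  obtain ⟨i, hji, hxi, hi⟩ :
      ∃ i ≥ j, x ∈ square (n + (2 * i + 3)) ∧ |a j - b| ≤ C * (1 / 256) ^ i := by
    by_cases hxj : x ∈ square (n + (2 * j + 1))
    · exact ⟨j, le_rfl, square_mono (by omega) hxj, hab j⟩
    · refine ⟨(max x.1.natAbs x.2.natAbs - n - 2) / 2, ?_, ?_, ?_⟩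
      · rw [mem_square] at hxj
        omega
      · rw [mem_square] at *
        omega
      · rw [ha j hxj, ← ha ((max x.1.natAbs x.2.natAbs - n - 2) / 2)]
        · exact hab _
        · rw [mem_square] at *
          omega
  calc |a j - b|
    _ ≤ C * ((1 / 16) ^ i * (1 / 16) ^ i) := by
      rw [← mul_pow]
      exact hi.trans_eq (by norm_num)
    _ ≤ C * ((1 / 16) ^ j * (4 ^ (n + 3) * weight x)) := by
      gcongr C * (?_ * ?_)
      · exact pow_le_pow_of_le_one (by norm_num) (by norm_num) hji
      · exact pow_le_weight hxi
    _ = C * 4 ^ (n + 3) * (1 / 16) ^ j * weight x := by ring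

end Weight

section Limit

lemma hasSum_influence {S : Finset Site} {F : Set (Site → ℝ)}
    (hS : DependsOn (· ∈ F) (S : Set Site)) (lam : ℝ) :
    HasSum (fun x : {x // EvenSite x} => influence F lam x)
      (∑ x ∈ evenSites S, influence F lam x) := by
  classical
  rw [evenSites, ← Finset.sum_subtype_eq_sum_filter]
  exact hasSum_sum_of_ne_finset_zero fun x hx =>
    influence_eq_zero hS lam fun hxS => hx (Finset.mem_subtype.2 hxS)

/-- The constant in the uniform bound on the error of the local approximations of an influence. -/
noncomputable def errorConst (n : ℕ) : ℝ := 2 * chainConst n * 4 ^ (n + 3)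

lemma tendsto_const_mul_pow {r : ℝ} (hr₀ : 0 ≤ r) (hr₁ : r < 1) (C : ℝ) :
    Filter.Tendsto (fun j : ℕ => C * r ^ j) Filter.atTop (nhds 0) := by
  simpa using (tendsto_pow_atTop_nhds_zero_of_lt_one hr₀ hr₁).const_mul C

variable {n : ℕ} {Φ : Finset Site → Prop} (hΦ : Monotone Φ)
include hΦ

lemma abs_influence_sub_le_weight (lam : ℝ) [Fact (0 < lam)] (j : ℕ) (x : {x // EvenSite x}) :
    |influence (blackEventBy (2 * j + 1) n Φ) lam x - influence (blackEvent n Φ) lam x| ≤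
      errorConst n * (1 / 16) ^ j * weight x := by
  refine abs_sub_le_weight (mul_nonneg two_pos.le (chainConst_nonneg n))
    (a := fun j => influence (blackEventBy (2 * j + 1) n Φ) lam x) (fun i hi => ?_)
    (fun i => abs_influence_sub_le hΦ lam i x.2) j
  exact influence_eq_zero (dependsOn_blackEventBy _ n Φ) lam hi

lemma summable_influence_blackEvent (lam : ℝ) [Fact (0 < lam)] :
    Summable fun x : {x // EvenSite x} => influence (blackEvent n Φ) lam x := by
  have hloc := (hasSum_influence (dependsOn_blackEventBy (2 * 0 + 1) n Φ) lam).summable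
  have herr : Summable fun x : {x // EvenSite x} =>
      influence (blackEventBy (2 * 0 + 1) n Φ) lam x - influence (blackEvent n Φ) lam x :=
    .of_norm_bounded ((summable_weight.subtype _).mul_left _)
      (abs_influence_sub_le_weight hΦ lam 0)
  simpa only [sub_sub_cancel] using hloc.sub herr

lemma abs_sum_influence_sub_tsum_le (lam : ℝ) [Fact (0 < lam)] (j : ℕ) :
    |∑ x ∈ evenSites (square (n + (2 * j + 1))),
        influence (blackEventBy (2 * j + 1) n Φ) lam x -
      ∑' x : {x // EvenSite x}, influence (blackEvent n Φ) lam x| ≤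
      errorConst n * (∑' x : {x // EvenSite x}, weight x) * (1 / 16) ^ j := by
  have hloc := hasSum_influence (dependsOn_blackEventBy (2 * j + 1) n Φ) lam
  have hw : Summable fun x : {x // EvenSite x} => weight x := summable_weight.subtype _
  rw [← Real.norm_eq_abs, ← hloc.tsum_eq,
    ← hloc.summable.tsum_sub (summable_influence_blackEvent hΦ lam), mul_right_comm,
    ← tsum_mul_left]
  exact tsum_of_norm_bounded (hw.mul_left _).hasSum
    (abs_influence_sub_le_weight hΦ lam j)

lemma tendsto_blackEventBy (lam : ℝ) [Fact (0 < lam)] :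
    Filter.Tendsto
      (fun j => (gapLaw lam).real (firstTimes ⁻¹' blackEventBy (2 * j + 1) n Φ))
      Filter.atTop (nhds ((gapLaw lam).real (firstTimes ⁻¹' blackEvent n Φ))) := by
  refine tendsto_iff_dist_tendsto_zero.2 (squeeze_zero (fun _ => dist_nonneg) (fun j => ?_)
    (tendsto_const_mul_pow (r := 1 / 256) (by norm_num) (by norm_num) (chainConst n)))
  rw [dist_comm, Real.dist_eq]
  exact abs_measureReal_blackEvent_sub_le hΦ lam j measurable_firstTimes fun _ _ _ => rfl

/-- The errors of the local approximations are bounded uniformly in the rate, so one may pass to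
the limit in the derivatives. -/
lemma hasDerivAt_blackEvent {lam : ℝ} (hlam : 0 < lam) :
    HasDerivAt (fun l => (gapLaw l).real (firstTimes ⁻¹' blackEvent n Φ))
      (1 / lam * ∑' x : {x // EvenSite x}, influence (blackEvent n Φ) lam x) lam := by
  have hpos {l : ℝ} (hl : l ∈ Set.Ioi (lam / 2)) : 0 < l := (half_pos hlam).trans hl
  refine hasDerivAt_of_tendstoUniformlyOn (s := Set.Ioi (lam / 2)) (l := Filter.atTop)
    (f := fun j l => (gapLaw l).real (firstTimes ⁻¹' blackEventBy (2 * j + 1) n Φ))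
    (f' := fun j l => 1 / l * ∑ x ∈ evenSites (square (n + (2 * j + 1))),
      influence (blackEventBy (2 * j + 1) n Φ) l x)
    (g' := fun l => 1 / l * ∑' x : {x // EvenSite x}, influence (blackEvent n Φ) l x)
    isOpen_Ioi ?_ (.of_forall fun j l hl => ?_) (fun l hl => ?_) (half_lt_self hlam)
  · rw [Metric.tendstoUniformlyOn_iff]
    intro ε hε
    filter_upwards [(tendsto_const_mul_pow (r := 1 / 16) (by norm_num) (by norm_num)
      (1 / (lam / 2) * (errorConst n * ∑' x : {x // EvenSite x}, weight x))).eventually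
        (gt_mem_nhds hε)] with j hj l hl
    have : Fact (0 < l) := ⟨hpos hl⟩
    refine lt_of_le_of_lt ?_ hj
    rw [dist_comm, Real.dist_eq, ← mul_sub, abs_mul, abs_of_pos (one_div_pos.2 (hpos hl)),
      mul_assoc]
    exact mul_le_mul (one_div_le_one_div_of_le (half_pos hlam) hl.le)
      (abs_sum_influence_sub_tsum_le hΦ l j) (abs_nonneg _) (by positivity)
  · exact hasDerivAt_gapLaw_real_influence (hpos hl) (measurableSet_blackEventBy _ n Φ)
      (dependsOn_blackEventBy _ n Φ)
  · have : Fact (0 < l) := ⟨hpos hl⟩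
    exact tendsto_blackEventBy hΦ l

end Limit

/-! ### Crossings -/

section Crossings

/-- The colouring of the faces with black octagons at the sites of `B` and black diamonds at the
sites of `A`. -/
def FaceIn (B A : Finset Site) : Face → Prop
  | .octagon z => z ∈ B
  | .diamond z => z ∈ A

/-- The crossing event of `B(2n)`, as a property of the sets `B` of black octagons and `A` of black
diamonds. -/
def Crosses (n : ℕ) (B A : Finset Site) : Prop :=
  ∃ (u v : Site) (w : centredQuadraticLattice.Walk (.octagon u) (.octagon v)),
    u.1 = -(n : ℤ) ∧ v.1 = (n : ℤ) - 1 ∧ ∀ f ∈ w.support, InBox n f ∧ FaceIn B A f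

lemma FaceIn.mono {B B' A A' : Finset Site} (hB : B ⊆ B') (hA : A ⊆ A') :
    ∀ {f : Face}, FaceIn B A f → FaceIn B' A' f
  | .octagon _, h => hB h
  | .diamond _, h => hA h

lemma Crosses.mono {n : ℕ} {B B' A A' : Finset Site} (hB : B ⊆ B') (hA : A ⊆ A') :
    Crosses n B A → Crosses n B' A' := fun ⟨u, v, w, hu, hv, hw⟩ =>
  ⟨u, v, w, hu, hv, fun f hf => ⟨(hw f hf).1, (hw f hf).2.mono hB hA⟩⟩

lemma monotone_crosses (n : ℕ) (A : Finset Site) : Monotone (Crosses n · A) :=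
  fun _ _ hB => Crosses.mono hB subset_rfl

open Classical in
/-- The sites of `[-n, n] × [-n, n]` whose diamond is black. -/
noncomputable def blackDiamonds (n : ℕ) (p : ℝ) (T : Site → unitInterval) : Finset Site :=
  (square n).filter fun z => (T z : ℝ) < p

lemma mem_blackDiamonds {n : ℕ} {p : ℝ} {T : Site → unitInterval} {z : Site} :
    z ∈ blackDiamonds n p T ↔ z ∈ square n ∧ (T z : ℝ) < p := by
  simp [blackDiamonds]

lemma crossing_iff {n : ℕ} {p : ℝ} {t : Site → ℝ} {T : Site → unitInterval} :
    Crossing n p t T ↔ Crosses n (blackSites n t) (blackDiamonds n p T) := by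
  have hface (f : Face) (hf : InBox n f) :
      Black p t T f ↔ FaceIn (blackSites n t) (blackDiamonds n p T) f := by
    rcases f with z | z <;> simp only [InBox] at hf
    · exact (mem_blackSites.trans (and_iff_right (mem_square.2 (by omega)))).symm
    · exact (mem_blackDiamonds.trans (and_iff_right (mem_square.2 (by omega)))).symm
  refine exists_congr fun u => exists_congr fun v => exists_congr fun w =>
    and_congr_right fun _ => and_congr_right fun _ => forall₂_congr fun f _ => ?_
  exact and_congr_right (hface f)

lemma blackDiamonds_update_zero {n : ℕ} {p : ℝ} (hp : 0 < p) (T : Site → unitInterval) {x : Site}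
    (hx : x ∈ square n) :
    blackDiamonds n p (Function.update T x 0) = insert x (blackDiamonds n p T) := by
  ext y
  obtain rfl | hy := eq_or_ne y x <;> simp [mem_blackDiamonds, *]

lemma blackDiamonds_update_one {n : ℕ} {p : ℝ} (hp : p ≤ 1) (T : Site → unitInterval) (x : Site) :
    blackDiamonds n p (Function.update T x 1) = (blackDiamonds n p T).erase x := by
  ext y
  obtain rfl | hy := eq_or_ne y x <;> simp [mem_blackDiamonds, *]

lemma blackDiamonds_update_of_notMem {n : ℕ} {x : Site} (hx : x ∉ square n) (p : ℝ)
    (T : Site → unitInterval) (a : unitInterval) :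
    blackDiamonds n p (Function.update T x a) = blackDiamonds n p T := by
  ext y
  obtain rfl | hy := eq_or_ne y x <;> simp [mem_blackDiamonds, *]

lemma firstArrival_eq (ω : Sample) : firstArrival ω = firstTimes ω.1 :=
  funext fun x => by simp [firstArrival, arrival, firstTimes]

lemma update_secondArrival_eq (x : Site) (ω : Sample) :
    Function.update (firstTimes ω.1) x (secondArrival ω x) = delayedTimes x ω.1 := by
  rw [delayedTimes, secondArrival, arrival]
  simp [Finset.sum_range_succ]

end Crossings

section Probabilities

lemma law_real_eq_bernoulliMean (n : ℕ) (lam : ℝ) [Fact (0 < lam)] {p : ℝ}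
    (hp : p ∈ Set.Icc (0 : ℝ) 1) {Q : (Site × ℕ → ℝ) → Finset Site → Prop}
    (hQ : ∀ A, MeasurableSet {g | Q g A}) :
    (law lam).real {ω | Q ω.1 (blackDiamonds n p ω.2)} =
      bernoulliMean (square n) (fun A => (gapLaw lam).real {g | Q g A}) p := by
  classical
  have hF (A : Finset Site) : MeasurableSet {T | blackDiamonds n p T = A} :=
    measurableSet_filter_eq fun z => measurableSet_lt (by fun_prop) measurable_const
  rw [law, measureReal_prod_finset _ _ hF (fun T => Finset.filter_subset _ _) hQ, bernoulliMean]
  refine Finset.sum_congr rfl fun A hA => ?_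
  have hvol : (volume : Measure unitInterval).real (Set.Iio ⟨p, hp⟩) = p := by
    rw [measureReal_def, unitInterval.volume_Iio, ENNReal.toReal_ofReal hp.1]
  have h := measureReal_infinitePi_filter_mem_eq (μ := (volume : Measure unitInterval))
    (measurableSet_Iio (a := ⟨p, hp⟩)) (Finset.mem_powerset.1 hA)
  rw [hvol] at h
  exact congrArg (· * _) h

/-- The event, in terms of the arrival times, that there is a crossing when `A` is the set of black
diamonds. -/
def crossEvent (n : ℕ) (A : Finset Site) : Set (Site → ℝ) := blackEvent n (Crosses n · A)

lemma measurableSet_crossEvent (n : ℕ) (A : Finset Site) : MeasurableSet (crossEvent n A) :=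
  measurableSet_blackEvent _ _

lemma crossEvent_mono (n : ℕ) : Monotone (crossEvent n) :=
  fun _ _ hA _ => Crosses.mono subset_rfl hA

lemma h_eq_bernoulliMean (n : ℕ) (lam : ℝ) [Fact (0 < lam)] {p : ℝ} (hp : p ∈ Set.Icc (0 : ℝ) 1) :
    h n lam p =
      bernoulliMean (square n) (fun A => (gapLaw lam).real (firstTimes ⁻¹' crossEvent n A)) p := by
  simp only [h, crossing_iff, firstArrival_eq]
  exact law_real_eq_bernoulliMean n lam hp (Q := fun g A => firstTimes g ∈ crossEvent n A)
    fun A => measurable_firstTimes (measurableSet_crossEvent n A)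

/-- Delaying the arrival at an even site can only destroy a crossing. -/
lemma measureReal_crossEvent_sdiff (n : ℕ) (lam : ℝ) [Fact (0 < lam)] {x : Site}
    (hx : EvenSite x) (A : Finset Site) :
    (gapLaw lam).real (firstTimes ⁻¹' crossEvent n A \ delayedTimes x ⁻¹' crossEvent n A) =
      influence (crossEvent n A) lam x := by
  have hle : delayedTimes x ⁻¹' crossEvent n A ≤ᵐ[gapLaw lam] firstTimes ⁻¹' crossEvent n A := by
    filter_upwards [ae_nonneg_gap lam (x, 1)] with g hg
    refine Crosses.mono (fun y hy => ?_) subset_rfl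
    rw [mem_blackSites] at *
    refine hy.imp_right (BlackSite.anti (fun z _ => ?_) (fun z hz => ?_))
    · obtain rfl | hzx := eq_or_ne z x
      · simpa [delayedTimes, firstTimes] using hg
      · exact (Function.update_of_ne hzx _ _).ge
    · exact (Function.update_of_ne (by rintro rfl; exact hz hx) _ _).le
  have hdel := measurable_delayedTimes x (measurableSet_crossEvent n A)
  rw [measureReal_sdiff' hdel, measureReal_congr (union_ae_eq_left_iff_ae_subset.2 hle), influence]

lemma P₁_eq_bernoulliMean (n : ℕ) (lam : ℝ) [Fact (0 < lam)] {p : ℝ} (hp : p ∈ Set.Icc (0 : ℝ) 1)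
    {x : Site} (hx : EvenSite x) :
    P₁ n lam p x = bernoulliMean (square n) (fun A => influence (crossEvent n A) lam x) p := by
  simp only [P₁, Pivotal₁, crossing_iff, Function.update_eq_self, update_secondArrival_eq,
    firstArrival_eq, ← measureReal_crossEvent_sdiff n lam hx]
  exact law_real_eq_bernoulliMean n lam hp
    (Q := fun g A => firstTimes g ∈ crossEvent n A ∧ delayedTimes x g ∉ crossEvent n A)
    fun A => (measurable_firstTimes (measurableSet_crossEvent n A)).diff
      (measurable_delayedTimes x (measurableSet_crossEvent n A))

lemma P₂_eq_bernoulliMean (n : ℕ) (lam : ℝ) [Fact (0 < lam)] {p : ℝ} (hp : p ∈ Set.Ioc (0 : ℝ) 1)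
    {x : Site} (hx : x ∈ square n) :
    P₂ n lam p x = bernoulliMean (square n) (fun A =>
      (gapLaw lam).real (firstTimes ⁻¹' crossEvent n (insert x A)) -
        (gapLaw lam).real (firstTimes ⁻¹' crossEvent n (A.erase x))) p := by
  have hmeas (A : Finset Site) : MeasurableSet (firstTimes ⁻¹' crossEvent n A) :=
    measurable_firstTimes (measurableSet_crossEvent n A)
  have hsub (A : Finset Site) :
      firstTimes ⁻¹' crossEvent n (A.erase x) ⊆ firstTimes ⁻¹' crossEvent n (insert x A) :=
    Set.preimage_mono (crossEvent_mono n ((A.erase_subset x).trans (A.subset_insert x)))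
  have hsdiff (A : Finset Site) := measureReal_sdiff (μ := gapLaw lam) (hsub A) (hmeas (A.erase x))
  simp only [P₂, Pivotal₂, crossing_iff, firstArrival_eq, blackDiamonds_update_zero hp.1 _ hx,
    blackDiamonds_update_one hp.2, ← hsdiff]
  exact law_real_eq_bernoulliMean n lam ⟨hp.1.le, hp.2⟩
    (Q := fun g A => firstTimes g ∈ crossEvent n (insert x A) ∧
      firstTimes g ∉ crossEvent n (A.erase x))
    fun A => (hmeas (insert x A)).diff (hmeas (A.erase x))

lemma P₂_eq_zero {n : ℕ} {x : Site} (hx : x ∉ square n) (lam p : ℝ) : P₂ n lam p x = 0 := by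
  simp [P₂, Pivotal₂, crossing_iff, blackDiamonds_update_of_notMem hx]

end Probabilities

section Derivatives

lemma hasSum_P₁ (n : ℕ) (lam : ℝ) [Fact (0 < lam)] {p : ℝ} (hp : p ∈ Set.Icc (0 : ℝ) 1) :
    HasSum (fun x : {x // EvenSite x} => P₁ n lam p x)
      (bernoulliMean (square n)
        (fun A => ∑' x : {x // EvenSite x}, influence (crossEvent n A) lam x) p) := by
  simp only [fun x : {x // EvenSite x} => P₁_eq_bernoulliMean n lam hp x.2]
  exact hasSum_sum fun A _ =>
    (summable_influence_blackEvent (monotone_crosses n A) lam).hasSum.mul_left _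

lemma hasDerivAt_h_rate (n : ℕ) {lam p : ℝ} (hlam : 0 < lam) (hp : p ∈ Set.Icc (0 : ℝ) 1) :
    HasDerivAt (fun l => h n l p) (1 / lam * ∑' x : {x // EvenSite x}, P₁ n lam p x) lam := by
  have : Fact (0 < lam) := ⟨hlam⟩
  have hderiv := HasDerivAt.fun_sum (u := (square n).powerset) fun A _ =>
    (hasDerivAt_blackEvent (n := n) (monotone_crosses n A) hlam).const_mul
      (p ^ A.card * (1 - p) ^ ((square n).card - A.card))
  refine (hderiv.congr_of_eventuallyEq ?_).congr_deriv ?_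
  · filter_upwards [lt_mem_nhds hlam] with l hl
    have : Fact (0 < l) := ⟨hl⟩
    exact h_eq_bernoulliMean n l hp
  · rw [(hasSum_P₁ n lam hp).tsum_eq, bernoulliMean, Finset.mul_sum]
    exact Finset.sum_congr rfl fun A _ => mul_left_comm _ _ _

lemma hasSum_P₂ (n : ℕ) (lam p : ℝ) : HasSum (P₂ n lam p) (∑ x ∈ square n, P₂ n lam p x) :=
  hasSum_sum_of_ne_finset_zero fun _ hx => P₂_eq_zero hx lam p

lemma hasDerivWithinAt_h_enhancement (n : ℕ) {lam p : ℝ} (hlam : 0 < lam)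
    (hp : p ∈ Set.Ioc (0 : ℝ) 1) :
    HasDerivWithinAt (h n lam) (∑' x, P₂ n lam p x) (Set.Icc 0 1) p := by
  have : Fact (0 < lam) := ⟨hlam⟩
  have hderiv := hasDerivAt_bernoulliMean (square n)
    (fun A => (gapLaw lam).real (firstTimes ⁻¹' crossEvent n A)) p
  rw [← Finset.sum_congr rfl fun x hx => P₂_eq_bernoulliMean n lam hp hx,
    ← (hasSum_P₂ n lam p).tsum_eq] at hderiv
  exact hderiv.hasDerivWithinAt.congr (fun q hq => h_eq_bernoulliMean n lam hq)
    (h_eq_bernoulliMean n lam ⟨hp.1.le, hp.2⟩)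

end Derivatives

end RSA

theorem proposition4p2 (n : ℕ) (lam : ℝ) (hlam : 0 < lam) :
    (∀ p ∈ Set.Icc (0 : ℝ) 1,
      Summable (fun x : {x : RSA.Site // RSA.EvenSite x} => RSA.P₁ n lam p x) ∧
      HasDerivAt (fun l : ℝ => RSA.h n l p)
        ((1 / lam) * ∑' x : {x : RSA.Site // RSA.EvenSite x}, RSA.P₁ n lam p x) lam) ∧
    (∀ p ∈ Set.Ioc (0 : ℝ) 1,
      Summable (fun x : RSA.Site => RSA.P₂ n lam p x) ∧
      HasDerivWithinAt (fun q : ℝ => RSA.h n lam q)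
        (∑' x : RSA.Site, RSA.P₂ n lam p x) (Set.Icc 0 1) p) := by
  have : Fact (0 < lam) := ⟨hlam⟩
  exact ⟨fun p hp => ⟨(RSA.hasSum_P₁ n lam hp).summable, RSA.hasDerivAt_h_rate n hlam hp⟩,
    fun p hp => ⟨(RSA.hasSum_P₂ n lam p).summable,
      RSA.hasDerivWithinAt_h_enhancement n hlam hp⟩⟩
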